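/- **Setting.** Let $f:\mathbb{R}^n\to\mathbb{R}$ be a differentiable convex function whose gradient is Lipschitz continuous with modulus $L>0$, i.e. $\|\nabla f(u)-\nabla f(v)\|\le L\|u-v\|$ for all $u,v$. Let $C\subseteq\mathbb{R}^n$ be nonempty, closed and convex. Let $\phi:[0,\infty)\to[0,\infty)$ be continuous and concave with $\phi(0)=0$, continuously differentiable on $(0,\infty)$, and such that the (finite) limit $\lim_{t\downarrow0}\phi'(t)$ exists. Write $\phi'_+$ for its right-hand derivative on $[0,\infty)$, $\Phi(|x|)=\sum_{i=1}^n\phi(|x_i|)$, $\delta_C$ for the indicator function of $C$ ($0$ on $C$, $+\infty$ elsewhere), and $$F(x)=f(x)+\delta_C(x)+\Phi(|x|).$$ Assume that $F$ is level-bounded, i.e. $\{x: F(x)\le\alpha\}$ is bounded for every $\alpha\in\mathbb{R}$. The problem is to minimize $F$ over $\mathbb{R}^n$. **Algorithm IRL$_1e_3$.** Given $x^0,z^0\in C$ and $\{\theta_k\}_{k\ge0}\subset(0,1]$, for $k=0,1,2,\dots$ set $$s^{k+1}_i=\phi'_+(|x^k_i|)\ (1\le i\le n),\qquad y^k=(1-\theta_k)x^k+\theta_kz^k,$$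 $$z^{k+1}=\operatorname*{argmin}_{v\in C}\Big\{\langle\nabla f(y^k),v-y^k\rangle+\tfrac{L\theta_k}{2}\|v-z^k\|^2+\sum_{i=1}^n s^{k+1}_i|v_i|\Big\},$$ $$x^{k+1}=\operatorname*{argmin}_{v\in C}\Big\{\langle\nabla f(y^k),v-y^k\rangle+\tfrac{L}{2}\|v-y^k\|^2+\sum_{i=1}^n s^{k+1}_i|v_i|\Big\}.$$ **Definitions.** For a proper function $h:\mathbb{R}^m\to(-\infty,\infty]$ and $x\in\operatorname{dom}h=\{h<\infty\}$, let $$\hat\partial h(x)=\Big\{\zeta:\liminf_{z\to x,\,z\ne x}\frac{h(z)-h(x)-\langle\zeta,z-x\rangle}{\|z-x\|}\ge0\Big\},$$ and let $\partial h(x)$ be the set of all $\zeta$ for which there are $u^k\to x$ with $h(u^k)\to h(x)$ and $\zeta^k\to\zeta$ with $\zeta^k\in\hat\partial h(u^k)$ for every $k$; both sets are empty for $x\notin\operatorname{dom}h$. A *stationary point* of the problem is a point $\bar x$ with $0\in\partial F(\bar x)$. A proper lower semicontinuous function $h$ is a *KL function* if for every $\hat x$ with $\partial h(\hat x)\ne\emptyset$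 there exist $a\in(0,\infty]$, a neighborhood $V$ of $\hat x$ and a concave continuous function $\varphi:[0,a)\to[0,\infty)$ with $\varphi(0)=0$, continuously differentiable on $(0,a)$ with $\varphi'>0$ there, such that $$\varphi'(h(x)-h(\hat x))\,\operatorname{dist}(0,\partial h(x))\ge1$$ for all $x\in V$ with $h(\hat x)<h(x)<h(\hat x)+a$ (where $\operatorname{dist}(0,\emptyset)=\infty$). Finally, for $x,y,w\in\mathbb{R}^n$, let $$H_3(x,y,w)=f(x)+\delta_C(x)+\Phi(|x|)+\tfrac L2\|w-y\|^2+\tfrac L2\|w-x\|^2 .$$ **Theorem.** Suppose that, for some $\gamma\in(0,1)$, $$\sup_{k\ge1}\max\Big\{\frac{\theta_k^2(1-\theta_{k-1})^2}{\gamma}-\theta_{k-1}^2,\ \frac{\theta_k^2}{1-\gamma}-1\Big\}<0,$$ that $H_3$ is a KL function on $\mathbb{R}^n\times\mathbb{R}^n\times\mathbb{R}^n$, and that $\phi'_+$ is Lipschitz continuous on $[0,\infty)$. Then the sequence $\{x^k\}$ generated by IRL$_1e_3$ satisfies $$\sum_{k=1}^\infty\|x^k-x^{k-1}\|<\infty,$$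 and $\{x^k\}$ converges to a stationary point of the problem. -/

import Mathlib

open Filter Topology Set
open scoped InnerProductSpace

noncomputable section

namespace IRL

section Variational

variable {V : Type*} [NormedAddCommGroup V] [InnerProductSpace ℝ V]

/-- The effective domain of an extended-real-valued function. -/
def dom (h : V → EReal) : Set V := {x | h x < ⊤}

/-- A proper function with values in `(-∞, ∞]`. -/
def IsProper (h : V → EReal) : Prop := (∀ x, ⊥ < h x) ∧ (dom h).Nonempty

/-- The indicator function `δ_C`. -/
def indicatorFn (C : Set V) (x : V) : EReal := by
  classical exact if x ∈ C then 0 else ⊤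

/-- The regular (Fréchet) subdifferential; empty outside the domain. -/
def regularSubdiff (h : V → EReal) (x : V) : Set V :=
  {ζ | x ∈ dom h ∧
    0 ≤ liminf (fun z => (h z - h x - ((⟪ζ, z - x⟫_ℝ : ℝ) : EReal)) / ((‖z - x‖ : ℝ) : EReal))
      (𝓝[≠] x)}

/-- The (limiting) subdifferential `∂h(x)`; empty outside the domain. -/
def subdiff (h : V → EReal) (x : V) : Set V :=
  {ζ | x ∈ dom h ∧ ∃ (u : ℕ → V) (v : ℕ → V),
    Tendsto u atTop (𝓝 x) ∧ Tendsto (fun k => h (u k)) atTop (𝓝 (h x)) ∧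
    Tendsto v atTop (𝓝 ζ) ∧ ∀ k, v k ∈ regularSubdiff h (u k)}

/-- The domain of the subdifferential. -/
def domSubdiff (h : V → EReal) : Set V := {x | (subdiff h x).Nonempty}

/-- The class `Ξ_a`, `a ∈ (0, ∞]`, of concave continuous `φ : [0, a) → [0, ∞)`, continuously
differentiable on `(0, a)` with positive derivative and `φ 0 = 0`. Only the values of `φ` on
`[0, a)` are used. -/
structure IsDesingularizing (a : EReal) (φ : ℝ → ℝ) : Prop where
  concave : ConcaveOn ℝ {t : ℝ | 0 ≤ t ∧ (t : EReal) < a} φ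
  continuousOn : ContinuousOn φ {t : ℝ | 0 ≤ t ∧ (t : EReal) < a}
  nonneg : ∀ t : ℝ, 0 ≤ t → (t : EReal) < a → 0 ≤ φ t
  contDiffOn : ContDiffOn ℝ 1 φ {t : ℝ | 0 < t ∧ (t : EReal) < a}
  deriv_pos : ∀ t : ℝ, 0 < t → (t : EReal) < a → 0 < deriv φ t
  map_zero : φ 0 = 0

/-- The Kurdyka–Łojasiewicz property at `x̂`. The distance to the subdifferential is
`ℝ≥0∞`-valued, so the distance to the empty set is `∞`. -/
def KLPropertyAt (h : V → EReal) (xhat : V) : Prop :=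
  ∃ a : EReal, 0 < a ∧ ∃ U ∈ 𝓝 xhat, ∃ φ : ℝ → ℝ, IsDesingularizing a φ ∧
    ∀ x ∈ U, h xhat < h x → h x < h xhat + a →
      1 ≤ ENNReal.ofReal (deriv φ (h x - h xhat).toReal) * Metric.infEDist 0 (subdiff h x)

/-- A KL function: a proper closed function with the KL property at every point of `dom ∂h`. -/
def IsKLFunction (h : V → EReal) : Prop :=
  IsProper h ∧ LowerSemicontinuous h ∧ ∀ x ∈ domSubdiff h, KLPropertyAt h x

/-- Level-boundedness: all sublevel sets are bounded. -/
def LevelBounded (h : V → EReal) : Prop :=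
  ∀ α : ℝ, Bornology.IsBounded {x | h x ≤ (α : EReal)}

/-- A point satisfying the first-order necessary condition `0 ∈ ∂h(x)`. -/
def IsStationaryPoint (h : V → EReal) (x : V) : Prop := (0 : V) ∈ subdiff h x

/-- `z` minimizes `g` over `C`. -/
def IsArgmin (g : V → ℝ) (C : Set V) (z : V) : Prop := z ∈ C ∧ IsMinOn g C z

end Variational

/-- The right-hand derivative `φ'_+`. -/
def rightDeriv (φ : ℝ → ℝ) (t : ℝ) : ℝ := derivWithin φ (Ioi t) t

/-- Standing assumptions on `φ : [0, ∞) → [0, ∞)`; only the values of `φ` on `[0, ∞)` are used. -/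
structure IsPenalty (φ : ℝ → ℝ) : Prop where
  nonneg : ∀ t, 0 ≤ t → 0 ≤ φ t
  continuousOn : ContinuousOn φ (Ici 0)
  concave : ConcaveOn ℝ (Ici 0) φ
  map_zero : φ 0 = 0
  contDiffOn : ContDiffOn ℝ 1 φ (Ioi 0)
  deriv_tendsto : ∃ l : ℝ, Tendsto (deriv φ) (𝓝[>] 0) (𝓝 l)

variable {n : ℕ}

/-- The regularizer `x ↦ Φ(|x|) = ∑ φ(|x_i|)`. -/
def penalty (φ : ℝ → ℝ) (x : EuclideanSpace ℝ (Fin n)) : ℝ := ∑ i, φ |x i|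

/-- The objective `F(x) = f(x) + δ_C(x) + Φ(|x|)`. -/
def objective (f : EuclideanSpace ℝ (Fin n) → ℝ) (C : Set (EuclideanSpace ℝ (Fin n)))
    (φ : ℝ → ℝ) (x : EuclideanSpace ℝ (Fin n)) : EReal :=
  (f x : EReal) + indicatorFn C x + (penalty φ x : EReal)

/-- The potential `H₃(x, y, w)` on the Euclidean space `ℝⁿ × ℝⁿ × ℝⁿ`, whose elements are
written `u = (u 0, u 1, u 2) = (x, y, w)`. -/
def potential (f : EuclideanSpace ℝ (Fin n) → ℝ) (C : Set (EuclideanSpace ℝ (Fin n)))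
    (φ : ℝ → ℝ) (L : ℝ) (u : PiLp 2 (fun _ : Fin 3 => EuclideanSpace ℝ (Fin n))) : EReal :=
  objective f C φ (u 0) + ((L / 2 * ‖u 2 - u 1‖ ^ 2 : ℝ) : EReal)
    + ((L / 2 * ‖u 2 - u 0‖ ^ 2 : ℝ) : EReal)

/-- `x, y, z, s` are generated by the iteratively reweighted `ℓ₁` algorithm with type-III
extrapolation, run with extrapolation parameters `θ`. -/
structure IsIRL1e3 (f : EuclideanSpace ℝ (Fin n) → ℝ) (C : Set (EuclideanSpace ℝ (Fin n)))
    (φ : ℝ → ℝ) (L : ℝ) (θ : ℕ → ℝ) (x y z s : ℕ → EuclideanSpace ℝ (Fin n)) : Prop where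
  theta_mem : ∀ k, θ k ∈ Ioc (0 : ℝ) 1
  x_zero : x 0 ∈ C
  z_zero : z 0 ∈ C
  s_step : ∀ k i, s (k + 1) i = rightDeriv φ |x k i|
  y_step : ∀ k, y k = (1 - θ k) • x k + θ k • z k
  z_step : ∀ k, IsArgmin (fun v => ⟪gradient f (y k), v - y k⟫_ℝ
      + L * θ k / 2 * ‖v - z k‖ ^ 2 + ∑ i, s (k + 1) i * |v i|) C (z (k + 1))
  x_step : ∀ k, IsArgmin (fun v => ⟪gradient f (y k), v - y k⟫_ℝ
      + L / 2 * ‖v - y k‖ ^ 2 + ∑ i, s (k + 1) i * |v i|) C (x (k + 1))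

/-- The condition on the extrapolation parameters (the supremum runs over the indices
`k + 1 ≥ 1`; for parameters in `(0, 1]` it is over a bounded family). -/
def ThetaCondition (θ : ℕ → ℝ) : Prop :=
  ∃ γ ∈ Ioo (0 : ℝ) 1,
    (⨆ k : ℕ, max (θ (k + 1) ^ 2 * (1 - θ k) ^ 2 / γ - θ k ^ 2)
      (θ (k + 1) ^ 2 / (1 - γ) - 1)) < 0

end IRL

end

/-!
The iterates are monitored through the potential `H₃` at the triples
`(x (k + 1), x k, w k)`, where `w k = (1 - θ k) x k + θ k z (k + 1)`.

Sufficient decrease. The descent lemma for `f`, concavity of `φ` (the weights `s` are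
supergradients) and the strong convexity of the two subproblems, with the `x`-subproblem tested
at `w k` and the `z`-subproblem at `x k`, bound the potential after step `k` by
`F (x k) + L θ_k² / 2 ‖x k - z k‖²`. Splitting `z k - x k` through `w (k - 1)` with the weights
`γ` and `1 - γ`, the parameter condition makes the potential drop by a fixed multiple of `D k ^ 2`,
where `D k = ‖z (k + 1) - x k‖ + ‖w k - x (k + 1)‖` bounds all displacements in the step
(`IRL.IsIRL1e3.potentialValue_le`, `IRL.IsIRL1e3.potentialValue_succ_le`).

Relative error. The `x`-subproblem is optimal for the weights `φ'_+(|x k i|)`, while a subgradient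
of the objective at `x (k + 1)` needs the weights `φ'_+(|x (k + 1) i|)`. As `φ'_+` is Lipschitz,
changing the weights perturbs the subproblem by a function with slope of order
`‖x (k + 1) - x k‖`, and a Hahn–Banach separation (`IRL.exists_norm_le_forall_add_inner_nonneg`)
trades this perturbation for a linear one of the same size. This produces regular subgradients of
the objective and of the potential of size `O(D (k + 1) + D k)`
(`IRL.IsIRL1e3.exists_subgradient`, `IRL.potentialSubgradient_mem_regularSubdiff`).

Conclusion. Level-boundedness gives a cluster point of the iterates, at which `0` is a limiting
subgradient of the potential. The Kurdyka–Łojasiewicz inequality there, together with the two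
estimates, yields `∑ D k < ∞` (`IRL.summable_of_kl`), hence finite length and convergence, and the
subgradients of the objective, which tend to `0`, show that the limit is stationary.
-/

namespace IRL

/-! ### First-order inequalities for concave, convex and smooth functions -/

section FirstOrder

theorem _root_.ConcaveOn.le_add_hasFDerivWithinAt {V : Type*} [NormedAddCommGroup V]
    [NormedSpace ℝ V] {S : Set V} {g : V → ℝ} {g' : V →L[ℝ] ℝ} {x y : V} (hg : ConcaveOn ℝ S g)
    (hx : x ∈ S) (hy : y ∈ S) (hd : HasFDerivWithinAt g g' S x) :
    g y ≤ g x + g' (y - x) := by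
  have hmaps : MapsTo (fun t : ℝ => x + t • (y - x)) (Icc 0 1) S := by
    intro t ht
    have := hg.1 hx hy (sub_nonneg.2 ht.2) ht.1 (by ring)
    convert this using 1
    module
  have hline : HasDerivWithinAt (fun t : ℝ => x + t • (y - x)) (y - x) (Icc 0 1) 0 := by
    have := (((hasDerivAt_id (0 : ℝ)).smul_const (y - x)).const_add x).hasDerivWithinAt
      (s := Icc 0 1)
    simpa using this
  have hcomp : HasDerivWithinAt (fun t : ℝ => g (x + t • (y - x))) (g' (y - x)) (Icc 0 1) 0 := by
    have hd' : HasFDerivWithinAt g g' S (x + (0 : ℝ) • (y - x)) := by simpa using hd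
    exact hd'.comp_hasDerivWithinAt 0 hline hmaps
  have hslope := hasDerivWithinAt_iff_tendsto_slope.1 hcomp
  have hset : Icc (0 : ℝ) 1 \ {0} = Ioc 0 1 := by
    ext t; simp only [Set.mem_sdiff, mem_Icc, mem_singleton_iff, mem_Ioc]
    constructor
    · rintro ⟨⟨h, h'⟩, h''⟩; exact ⟨lt_of_le_of_ne h (Ne.symm h''), h'⟩
    · rintro ⟨h, h'⟩; exact ⟨⟨h.le, h'⟩, h.ne'⟩
  rw [hset, nhdsWithin_Ioc_eq_nhdsGT zero_lt_one] at hslope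
  have : g y - g x ≤ g' (y - x) := by
    refine ge_of_tendsto hslope ?_
    filter_upwards [Ioc_mem_nhdsGT (zero_lt_one' ℝ)] with t ht
    have h1 := hg.2 hx hy (sub_nonneg.2 ht.2) ht.1.le (by ring)
    have h2 : (1 - t) • x + t • y = x + t • (y - x) := by module
    rw [h2] at h1
    simp only [smul_eq_mul] at h1
    rw [slope_def_field]
    simp only [zero_smul, add_zero, sub_zero]
    rw [le_div_iff₀ ht.1]
    linarith
  linarith

variable {V : Type*} [NormedAddCommGroup V] [InnerProductSpace ℝ V]

theorem _root_.ConvexOn.add_inner_gradient_le [CompleteSpace V] {f : V → ℝ}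
    (hf : ConvexOn ℝ univ f) (hd : Differentiable ℝ f) (x y : V) :
    f x + ⟪gradient f x, y - x⟫_ℝ ≤ f y := by
  have h := hf.neg.le_add_hasFDerivWithinAt (mem_univ x) (mem_univ y)
    (hd x).hasFDerivAt.neg.hasFDerivWithinAt
  rw [inner_gradient_left]
  simp at h
  simp
  linarith

/-- The descent lemma: a function with `L`-Lipschitz gradient lies below the quadratic
majorant built from its first-order expansion. -/
theorem le_add_inner_gradient_add_sq [CompleteSpace V] {f : V → ℝ} {L : ℝ}
    (hd : Differentiable ℝ f) (hlip : ∀ u v, ‖gradient f u - gradient f v‖ ≤ L * ‖u - v‖)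
    (x y : V) :
    f y ≤ f x + ⟪gradient f x, y - x⟫_ℝ + L / 2 * ‖y - x‖ ^ 2 := by
  set d := y - x with hd_def
  let g : ℝ → ℝ := fun t => f (x + t • d) - t * ⟪gradient f x, d⟫_ℝ - L / 2 * t ^ 2 * ‖d‖ ^ 2
  have hg : ∀ t, HasDerivAt g (⟪gradient f (x + t • d), d⟫_ℝ - ⟪gradient f x, d⟫_ℝ
      - L * t * ‖d‖ ^ 2) t := by
    intro t
    have hline : HasDerivAt (fun t : ℝ => x + t • d) d t := by
      simpa using ((hasDerivAt_id t).smul_const d).const_add x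
    have h1 : HasDerivAt (fun t : ℝ => f (x + t • d)) (⟪gradient f (x + t • d), d⟫_ℝ) t := by
      rw [inner_gradient_left]
      exact (hd _).hasFDerivAt.comp_hasDerivAt t hline
    have h2 : HasDerivAt (fun t : ℝ => t * ⟪gradient f x, d⟫_ℝ) (⟪gradient f x, d⟫_ℝ) t := by
      simpa using (hasDerivAt_id t).mul_const (⟪gradient f x, d⟫_ℝ)
    have h3 : HasDerivAt (fun t : ℝ => L / 2 * t ^ 2 * ‖d‖ ^ 2) (L * t * ‖d‖ ^ 2) t := by
      refine (((hasDerivAt_pow 2 t).const_mul (L / 2)).mul_const (‖d‖ ^ 2)).congr_deriv ?_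
      push_cast
      ring
    exact (h1.sub h2).sub h3
  have hanti : AntitoneOn g (Icc 0 1) := by
    refine antitoneOn_of_deriv_nonpos (convex_Icc 0 1)
      (fun t _ => (hg t).continuousAt.continuousWithinAt)
      (fun t _ => (hg t).differentiableAt.differentiableWithinAt) ?_
    intro t ht
    rw [interior_Icc] at ht
    rw [(hg t).deriv, ← inner_sub_left]
    have h1 := real_inner_le_norm (gradient f (x + t • d) - gradient f x) d
    have h2 := hlip (x + t • d) x
    rw [add_sub_cancel_left, norm_smul, Real.norm_eq_abs, abs_of_pos ht.1] at h2
    have h3 := mul_le_mul_of_nonneg_right h2 (norm_nonneg d)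
    nlinarith
  have h := hanti (left_mem_Icc.2 zero_le_one) (right_mem_Icc.2 zero_le_one) zero_le_one
  simp only [g, one_smul, zero_smul, add_zero, hd_def, add_sub_cancel] at h
  rw [← hd_def] at h
  linarith

theorem norm_sq_convex_combination (a b : V) (t : ℝ) :
    ‖(1 - t) • a + t • b‖ ^ 2 =
      (1 - t) * ‖a‖ ^ 2 + t * ‖b‖ ^ 2 - t * (1 - t) * ‖b - a‖ ^ 2 := by
  rw [norm_add_sq_real, norm_sub_sq_real, norm_smul, norm_smul, mul_pow, mul_pow,
    real_inner_smul_left, real_inner_smul_right, real_inner_comm b a, Real.norm_eq_abs,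
    Real.norm_eq_abs, sq_abs, sq_abs]
  ring

/-- Quadratic growth of a proximal objective away from its minimizer. -/
theorem IsArgmin.quadratic_growth {C : Set V} {q : V → ℝ} {c : ℝ} {a x v : V}
    (hq : ConvexOn ℝ C q) (h : IsArgmin (fun v => q v + c / 2 * ‖v - a‖ ^ 2) C x)
    (hv : v ∈ C) :
    q x + c / 2 * ‖x - a‖ ^ 2 + c / 2 * ‖v - x‖ ^ 2 ≤ q v + c / 2 * ‖v - a‖ ^ 2 := by
  have key : ∀ t ∈ Ioo (0 : ℝ) 1,
      q x + c / 2 * ‖x - a‖ ^ 2 + c / 2 * (1 - t) * ‖v - x‖ ^ 2 ≤ q v + c / 2 * ‖v - a‖ ^ 2 := by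
    intro t ht
    have hmem := hq.1 h.1 hv (sub_nonneg.2 ht.2.le) ht.1.le (by ring)
    have h1 : q x + c / 2 * ‖x - a‖ ^ 2 ≤ _ := h.2 hmem
    have h2 := hq.2 h.1 hv (sub_nonneg.2 ht.2.le) ht.1.le (by ring)
    have h3 : (1 - t) • x + t • v - a = (1 - t) • (x - a) + t • (v - a) := by module
    simp only [h3, norm_sq_convex_combination, sub_sub_sub_cancel_right, smul_eq_mul] at h1 h2
    have h4 : 0 ≤ t * (q v + c / 2 * ‖v - a‖ ^ 2
        - (q x + c / 2 * ‖x - a‖ ^ 2 + c / 2 * (1 - t) * ‖v - x‖ ^ 2)) := by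
      linarith
    have := nonneg_of_mul_nonneg_right h4 ht.1
    linarith
  have hlim : Tendsto (fun t : ℝ => q x + c / 2 * ‖x - a‖ ^ 2 + c / 2 * (1 - t) * ‖v - x‖ ^ 2)
      (𝓝[>] 0) (𝓝 (q x + c / 2 * ‖x - a‖ ^ 2 + c / 2 * (1 - 0) * ‖v - x‖ ^ 2)) := by
    apply Tendsto.mono_left _ nhdsWithin_le_nhds
    exact Continuous.tendsto (by fun_prop) 0
  have := le_of_tendsto hlim
    (Filter.eventually_of_mem (Ioo_mem_nhdsGT zero_lt_one) key)
  simpa using this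

/-- The first-order optimality condition of a proximal step, with the quadratic linearized. -/
theorem IsArgmin.linearized {C : Set V} {q : V → ℝ} {c : ℝ} {a x v : V}
    (hq : ConvexOn ℝ C q) (h : IsArgmin (fun v => q v + c / 2 * ‖v - a‖ ^ 2) C x)
    (hv : v ∈ C) :
    q x ≤ q v + c * ⟪x - a, v - x⟫_ℝ := by
  have h1 := h.quadratic_growth hq hv
  have h2 : v - a = (x - a) + (v - x) := by abel
  rw [h2, norm_add_sq_real] at h1
  linarith

/-- A convex function which is minimized at `x` up to the slope `ε` becomes minimized
there after a linear perturbation of norm at most `ε`. This is the sum rule for the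
subdifferential of `h + ε‖· - x‖`, obtained by separating the epigraph of `h` from the
strict hypograph of the cone `-ε‖· - x‖`. -/
theorem exists_norm_le_forall_add_inner_nonneg [CompleteSpace V] {C : Set V} {h : V → ℝ} {x : V}
    {ε : ℝ} (hε : 0 ≤ ε) (hh : ConvexOn ℝ C h) (hx : x ∈ C)
    (hmin : ∀ v ∈ C, h x ≤ h v + ε * ‖v - x‖) :
    ∃ p : V, ‖p‖ ≤ ε ∧ ∀ v ∈ C, h x ≤ h v + ⟪p, v - x⟫_ℝ := by
  let A : Set (V × ℝ) := {w | w.2 < -(ε * ‖w.1‖)}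
  let B : Set (V × ℝ) := {w | w.1 + x ∈ C ∧ h (w.1 + x) - h x ≤ w.2}
  have hAconv : Convex ℝ A := by
    intro u hu v hv a b ha hb hab
    simp only [A, mem_ofPred_eq, Prod.snd_add, Prod.smul_snd, smul_eq_mul, Prod.fst_add,
      Prod.smul_fst] at hu hv ⊢
    have h1 : ‖a • u.1 + b • v.1‖ ≤ a * ‖u.1‖ + b * ‖v.1‖ := by
      refine (norm_add_le _ _).trans ?_
      rw [norm_smul, norm_smul, Real.norm_of_nonneg ha, Real.norm_of_nonneg hb]
    have h2 := mul_le_mul_of_nonneg_left h1 hε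
    rcases ha.eq_or_lt with rfl | ha'
    · have : b = 1 := by linarith
      subst this; simpa using hv
    · nlinarith [mul_lt_mul_of_pos_left hu ha', mul_le_mul_of_nonneg_left hv.le hb]
  have hAopen : IsOpen A := isOpen_lt continuous_snd (by fun_prop)
  have hBconv : Convex ℝ B := by
    intro u hu v hv a b ha hb hab
    simp only [B, mem_ofPred_eq, Prod.snd_add, Prod.smul_snd, smul_eq_mul, Prod.fst_add,
      Prod.smul_fst] at hu hv ⊢
    have h0 : a • u.1 + b • v.1 + x = a • (u.1 + x) + b • (v.1 + x) := by
      rw [smul_add, smul_add, add_add_add_comm, ← add_smul, hab, one_smul]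
    rw [h0]
    refine ⟨hh.1 hu.1 hv.1 ha hb hab, ?_⟩
    have h1 := hh.2 hu.1 hv.1 ha hb hab
    simp only [smul_eq_mul] at h1
    have h2 := mul_le_mul_of_nonneg_left hu.2 ha
    have h3 := mul_le_mul_of_nonneg_left hv.2 hb
    have h4 : h x = a * h x + b * h x := by rw [← add_mul, hab, one_mul]
    linarith
  have hdisj : Disjoint A B := by
    rw [Set.disjoint_left]
    rintro ⟨v, t⟩ ha hb
    simp only [A, B, mem_ofPred_eq] at ha hb
    have := hmin _ hb.1
    rw [add_sub_cancel_right] at this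
    linarith [hb.2]
  obtain ⟨g, u, hgA, hgB⟩ := geometric_hahn_banach_open hAconv hAopen hBconv hdisj
  have hsplit : ∀ v t, g (v, t) = g (v, 0) + t * g (0, 1) := by
    intro v t
    rw [← smul_eq_mul, ← map_smul, ← map_add]
    simp
  have hA : ∀ v t, t < -(ε * ‖v‖) → g (v, 0) + t * g (0, 1) < u := fun v t ht => by
    rw [← hsplit]; exact hgA (v, t) ht
  have hB : ∀ v t, v + x ∈ C → h (v + x) - h x ≤ t → u ≤ g (v, 0) + t * g (0, 1) :=
    fun v t h1 h2 => by rw [← hsplit]; exact hgB (v, t) ⟨h1, h2⟩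
  set c := g (0, 1) with hc
  have g00 : g ((0 : V), (0 : ℝ)) = 0 := map_zero g
  have hu : u ≤ 0 := by simpa [g00] using hB 0 0 (by simpa using hx) (by simp)
  have hcpos : 0 < c := by
    have := hA 0 (-1) (by simp)
    rw [g00] at this
    linarith
  have hcone : ∀ v, g (v, 0) ≤ ε * ‖v‖ * c + u := by
    intro v
    refine le_of_forall_pos_lt_add fun δ hδ => ?_
    have := hA v (-(ε * ‖v‖) - δ / c) (by have := div_pos hδ hcpos; linarith)
    have h2 : δ / c * c = δ := div_mul_cancel₀ _ hcpos.ne'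
    linarith [sub_mul (-(ε * ‖v‖)) (δ / c) c]
  have hu0 : u = 0 := le_antisymm hu (by simpa [g00] using hcone 0)
  let ℓ : V →L[ℝ] ℝ := g.comp (ContinuousLinearMap.inl ℝ V ℝ)
  have hℓ : ∀ v, ℓ v = g (v, 0) := fun v => by simp [ℓ]
  have hp : ∀ v, ⟪c⁻¹ • (InnerProductSpace.toDual ℝ V).symm ℓ, v⟫_ℝ = c⁻¹ * g (v, 0) := fun v => by
    rw [real_inner_smul_left, InnerProductSpace.toDual_symm_apply, hℓ]
  refine ⟨c⁻¹ • (InnerProductSpace.toDual ℝ V).symm ℓ, ?_, fun v hv => ?_⟩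
  · set p := c⁻¹ • (InnerProductSpace.toDual ℝ V).symm ℓ
    have h1 := hcone p
    have h2 := hp p
    rw [real_inner_self_eq_norm_sq] at h2
    have h3 : c⁻¹ * g (p, 0) ≤ c⁻¹ * (ε * ‖p‖ * c + u) :=
      mul_le_mul_of_nonneg_left h1 (inv_nonneg.2 hcpos.le)
    have h4 : c⁻¹ * (ε * ‖p‖ * c + u) = ε * ‖p‖ := by rw [hu0]; field_simp; ring
    rw [← h2, h4, sq] at h3
    by_contra! hlt
    have : ε * ‖p‖ < ‖p‖ * ‖p‖ := mul_lt_mul_of_pos_right hlt (hε.trans_lt hlt)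
    linarith
  · have h1 := hB (v - x) (h v - h x) (by simpa using hv) (by simp)
    rw [hp]
    have h2 : 0 ≤ c⁻¹ * (g (v - x, 0) + (h v - h x) * c) :=
      mul_nonneg (inv_nonneg.2 hcpos.le) (hu0 ▸ h1)
    have h3 : c⁻¹ * (g (v - x, 0) + (h v - h x) * c) = c⁻¹ * g (v - x, 0) + (h v - h x) := by
      field_simp
    linarith

end FirstOrder

/-! ### The penalty -/

section Penalty

variable {φ : ℝ → ℝ}

theorem IsPenalty.hasDerivWithinAt (hφ : IsPenalty φ) {t : ℝ} (ht : 0 ≤ t) :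
    HasDerivWithinAt φ (rightDeriv φ t) (Ici 0) t := by
  have hdiff : DifferentiableOn ℝ φ (Ioi 0) := hφ.contDiffOn.differentiableOn one_ne_zero
  rcases ht.eq_or_lt with rfl | ht
  · obtain ⟨l, hl⟩ := hφ.deriv_tendsto
    have h := hasDerivWithinAt_Ici_of_tendsto_deriv hdiff
      ((hφ.continuousOn 0 self_mem_Ici).mono Ioi_subset_Ici_self) self_mem_nhdsWithin hl
    have : rightDeriv φ 0 = l := (h.Ioi_of_Ici).derivWithin (uniqueDiffWithinAt_Ioi 0)
    rwa [this]
  · have h := (hdiff.differentiableAt (Ioi_mem_nhds ht)).hasDerivAt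
    have : rightDeriv φ t = deriv φ t := h.hasDerivWithinAt.derivWithin (uniqueDiffWithinAt_Ioi t)
    rw [this]
    exact h.hasDerivWithinAt

theorem IsPenalty.le_add_rightDeriv (hφ : IsPenalty φ) {t r : ℝ} (ht : 0 ≤ t) (hr : 0 ≤ r) :
    φ r ≤ φ t + rightDeriv φ t * (r - t) := by
  have := hφ.concave.le_add_hasFDerivWithinAt ht hr (hφ.hasDerivWithinAt ht).hasFDerivWithinAt
  simpa [mul_comm] using this

theorem IsPenalty.rightDeriv_nonneg (hφ : IsPenalty φ) {t : ℝ} (ht : 0 ≤ t) :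
    0 ≤ rightDeriv φ t := by
  by_contra! h
  -- A negative slope would push the nonnegative `φ` below `-1` far to the right.
  have h0 : 0 ≤ (φ t + 1) / -rightDeriv φ t :=
    div_nonneg (by linarith [hφ.nonneg t ht]) (by linarith)
  have h1 := hφ.le_add_rightDeriv ht (r := t + (φ t + 1) / -rightDeriv φ t) (by linarith)
  have h2 := hφ.nonneg (t + (φ t + 1) / -rightDeriv φ t) (by linarith)
  have h3 : rightDeriv φ t * ((φ t + 1) / -rightDeriv φ t) = -(φ t + 1) := by
    field_simp [h.ne]
  rw [add_sub_cancel_left, h3] at h1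
  linarith

variable {n : ℕ}

theorem IsPenalty.penalty_nonneg (hφ : IsPenalty φ) (x : EuclideanSpace ℝ (Fin n)) :
    0 ≤ penalty φ x :=
  Finset.sum_nonneg fun _ _ => hφ.nonneg _ (abs_nonneg _)

theorem IsPenalty.continuous_penalty (hφ : IsPenalty φ) :
    Continuous (penalty φ : EuclideanSpace ℝ (Fin n) → ℝ) := by
  refine continuous_finsetSum _ fun i _ => ?_
  exact hφ.continuousOn.comp_continuous (by fun_prop) fun x => mem_Ici.2 (abs_nonneg _)

theorem IsPenalty.penalty_le (hφ : IsPenalty φ) (x v : EuclideanSpace ℝ (Fin n)) :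
    penalty φ v ≤ penalty φ x + ∑ i, rightDeriv φ |x i| * (|v i| - |x i|) := by
  rw [penalty, penalty, ← Finset.sum_add_distrib]
  exact Finset.sum_le_sum fun i _ => hφ.le_add_rightDeriv (abs_nonneg _) (abs_nonneg _)

/-- Near `x` the penalty is, up to a little-o term, the weighted `ℓ₁` norm with weights
`φ'_+(|x i|)`. -/
theorem IsPenalty.eventually_le_penalty (hφ : IsPenalty φ) (x : EuclideanSpace ℝ (Fin n))
    {ε : ℝ} (hε : 0 < ε) :
    ∀ᶠ v in 𝓝 x, penalty φ x + ∑ i, rightDeriv φ |x i| * (|v i| - |x i|) - ε * ‖v - x‖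
      ≤ penalty φ v := by
  have hn : (0 : ℝ) < n + 1 := by positivity
  have h : ∀ i, ∀ᶠ v : EuclideanSpace ℝ (Fin n) in 𝓝 x,
      φ |x i| + rightDeriv φ |x i| * (|v i| - |x i|) - ε / (n + 1) * ‖v - x‖ ≤ φ |v i| := by
    intro i
    have hd := (hφ.hasDerivWithinAt (abs_nonneg (x i))).isLittleO.bound (div_pos hε hn)
    have ht : Tendsto (fun v : EuclideanSpace ℝ (Fin n) => |v i|) (𝓝 x) (𝓝[Ici 0] |x i|) :=
      tendsto_nhdsWithin_iff.2 ⟨Continuous.tendsto (by fun_prop) x,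
        Eventually.of_forall fun v => mem_Ici.2 (abs_nonneg _)⟩
    filter_upwards [ht.eventually hd] with v hv
    have h1 : ‖|v i| - |x i|‖ ≤ ‖v - x‖ := by
      refine (abs_abs_sub_abs_le_abs_sub _ _).trans ?_
      simpa using PiLp.norm_apply_le (v - x) i
    have h2 := mul_le_mul_of_nonneg_left h1 (div_pos hε hn).le
    have h3 := neg_le_of_abs_le (hv.trans h2)
    simp only [smul_eq_mul] at h3
    linarith
  filter_upwards [eventually_all.2 h] with v hv
  have h1 := Finset.sum_le_sum fun i (_ : i ∈ Finset.univ) => hv i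
  rw [Finset.sum_sub_distrib, Finset.sum_add_distrib] at h1
  simp only [Finset.sum_const, Finset.card_univ, Fintype.card_fin, nsmul_eq_mul] at h1
  have h2 : (n : ℝ) * (ε / (n + 1) * ‖v - x‖) ≤ ε * ‖v - x‖ := by
    rw [← mul_assoc]
    refine mul_le_mul_of_nonneg_right ?_ (norm_nonneg _)
    rw [mul_div_assoc', div_le_iff₀ hn]
    nlinarith
  simp only [penalty]
  linarith

end Penalty

end IRL

namespace IRL

/-! ### Subgradients of the objective and of the potential -/

section Subgradients

section General

variable {V : Type*} [NormedAddCommGroup V] [InnerProductSpace ℝ V]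

/-- An `ε`-`δ` criterion for regular subgradients. -/
theorem mem_regularSubdiff_of_eventually {h : V → EReal} {x ζ : V} {r : ℝ} (hx : h x = r)
    (H : ∀ ε > 0, ∀ᶠ z in 𝓝 x, ((r + ⟪ζ, z - x⟫_ℝ - ε * ‖z - x‖ : ℝ) : EReal) ≤ h z) :
    ζ ∈ regularSubdiff h x := by
  refine ⟨by simp [dom, hx], ?_⟩
  refine le_of_forall_lt_imp_le_of_dense fun c hc => ?_
  obtain ⟨d, hcd, hd⟩ := EReal.lt_iff_exists_real_btwn.1 hc
  have hd : d < 0 := by exact_mod_cast hd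
  refine le_liminf_of_le (by isBoundedDefault) ?_
  filter_upwards [(H (-d) (neg_pos.2 hd)).filter_mono nhdsWithin_le_nhds, self_mem_nhdsWithin]
    with z hz hne
  have hpos : 0 < ‖z - x‖ := norm_pos_iff.2 (sub_ne_zero.2 hne)
  refine hcd.le.trans ?_
  rw [EReal.le_div_iff_mul_le (by exact_mod_cast hpos) (EReal.coe_ne_top _), hx]
  calc ((d : ℝ) : EReal) * ((‖z - x‖ : ℝ) : EReal)
      = ((r + ⟪ζ, z - x⟫_ℝ - -d * ‖z - x‖ : ℝ) : EReal) - (r : EReal)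
          - ((⟪ζ, z - x⟫_ℝ : ℝ) : EReal) := by
        norm_cast
        ring
    _ ≤ h z - (r : EReal) - ((⟪ζ, z - x⟫_ℝ : ℝ) : EReal) :=
        EReal.sub_le_sub (EReal.sub_le_sub hz le_rfl) le_rfl

theorem regularSubdiff_subset_subdiff (h : V → EReal) (x : V) :
    regularSubdiff h x ⊆ subdiff h x := fun ζ hζ =>
  ⟨hζ.1, fun _ => x, fun _ => ζ, tendsto_const_nhds, tendsto_const_nhds, tendsto_const_nhds,
    fun _ => hζ⟩

end General

variable {n : ℕ} {f : EuclideanSpace ℝ (Fin n) → ℝ} {C : Set (EuclideanSpace ℝ (Fin n))}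
  {φ : ℝ → ℝ} {L : ℝ}

theorem objective_of_mem {x : EuclideanSpace ℝ (Fin n)} (hx : x ∈ C) :
    objective f C φ x = ((f x + penalty φ x : ℝ) : EReal) := by
  simp [objective, indicatorFn, hx]

theorem objective_of_notMem {x : EuclideanSpace ℝ (Fin n)} (hx : x ∉ C) :
    objective f C φ x = ⊤ := by
  simp [objective, indicatorFn, hx]

/-- The finite part of the potential: its values at the points with first component in `C`. -/
noncomputable def potentialValue (f : EuclideanSpace ℝ (Fin n) → ℝ) (φ : ℝ → ℝ) (L : ℝ)
    (u : PiLp 2 (fun _ : Fin 3 => EuclideanSpace ℝ (Fin n))) : ℝ :=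
  f (u 0) + penalty φ (u 0) + L / 2 * ‖u 2 - u 1‖ ^ 2 + L / 2 * ‖u 2 - u 0‖ ^ 2

theorem potential_of_mem {u : PiLp 2 (fun _ : Fin 3 => EuclideanSpace ℝ (Fin n))}
    (hu : u 0 ∈ C) : potential f C φ L u = (potentialValue f φ L u : EReal) := by
  rw [potential, objective_of_mem hu, potentialValue]
  norm_cast

theorem potential_of_notMem {u : PiLp 2 (fun _ : Fin 3 => EuclideanSpace ℝ (Fin n))}
    (hu : u 0 ∉ C) : potential f C φ L u = ⊤ := by
  rw [potential, objective_of_notMem hu, EReal.top_add_coe, EReal.top_add_coe]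

theorem continuous_potentialValue (hf : Continuous f) (hφ : IsPenalty φ) :
    Continuous (potentialValue f φ L) := by
  have := hφ.continuous_penalty (n := n)
  unfold potentialValue
  fun_prop

/-- If `p` is such that `∑ φ'_+(|x i|) |v i| + ⟪p, v⟫` is minimal over `C` at `x`, then
`∇f(x) - p` satisfies the defining inequality of a regular subgradient of the objective at `x`
along `C`. -/
theorem eventually_le_objective (hd : Differentiable ℝ f) (hf : ConvexOn ℝ univ f)
    (hφ : IsPenalty φ) {x p : EuclideanSpace ℝ (Fin n)}
    (hp : ∀ v ∈ C, ∑ i, rightDeriv φ |x i| * |x i|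
      ≤ ∑ i, rightDeriv φ |x i| * |v i| + ⟪p, v - x⟫_ℝ) {ε : ℝ} (hε : 0 < ε) :
    ∀ᶠ v in 𝓝 x, v ∈ C → f x + penalty φ x + ⟪gradient f x - p, v - x⟫_ℝ - ε * ‖v - x‖
      ≤ f v + penalty φ v := by
  filter_upwards [hφ.eventually_le_penalty x hε] with v hv hvC
  have h1 := hf.add_inner_gradient_le hd x v
  have h2 := hp v hvC
  simp only [mul_sub, Finset.sum_sub_distrib] at hv
  rw [inner_sub_left]
  linarith

theorem sub_mem_regularSubdiff_objective (hd : Differentiable ℝ f) (hf : ConvexOn ℝ univ f)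
    (hφ : IsPenalty φ) {x p : EuclideanSpace ℝ (Fin n)} (hx : x ∈ C)
    (hp : ∀ v ∈ C, ∑ i, rightDeriv φ |x i| * |x i|
      ≤ ∑ i, rightDeriv φ |x i| * |v i| + ⟪p, v - x⟫_ℝ) :
    gradient f x - p ∈ regularSubdiff (objective f C φ) x := by
  refine mem_regularSubdiff_of_eventually (objective_of_mem hx) fun ε hε => ?_
  filter_upwards [eventually_le_objective hd hf hφ hp hε] with v hv
  by_cases hvC : v ∈ C
  · rw [objective_of_mem hvC]
    exact_mod_cast hv hvC
  · rw [objective_of_notMem hvC]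
    exact le_top

/-- A subgradient of the potential: the given one of the objective plus the gradient of the
quadratic terms. -/
noncomputable def potentialSubgradient (L : ℝ) (ζ : EuclideanSpace ℝ (Fin n))
    (u : PiLp 2 (fun _ : Fin 3 => EuclideanSpace ℝ (Fin n))) :
    PiLp 2 (fun _ : Fin 3 => EuclideanSpace ℝ (Fin n)) :=
  WithLp.toLp 2 ![ζ - L • (u 2 - u 0), -(L • (u 2 - u 1)), L • (u 2 - u 1) + L • (u 2 - u 0)]

theorem half_norm_sq_ge {V : Type*} [NormedAddCommGroup V] [InnerProductSpace ℝ V]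
    (hL : 0 ≤ L) (a b : V) :
    L / 2 * ‖a‖ ^ 2 + L * ⟪a, b - a⟫_ℝ ≤ L / 2 * ‖b‖ ^ 2 := by
  have h : b = a + (b - a) := by abel
  have h1 : ‖b‖ ^ 2 = ‖a‖ ^ 2 + 2 * ⟪a, b - a⟫_ℝ + ‖b - a‖ ^ 2 := by
    conv_lhs => rw [h, norm_add_sq_real]
  rw [h1]
  nlinarith [mul_nonneg hL (sq_nonneg ‖b - a‖)]

theorem potentialSubgradient_mem_regularSubdiff (hL : 0 ≤ L) (hd : Differentiable ℝ f)
    (hf : ConvexOn ℝ univ f) (hφ : IsPenalty φ)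
    {u : PiLp 2 (fun _ : Fin 3 => EuclideanSpace ℝ (Fin n))} {p : EuclideanSpace ℝ (Fin n)}
    (hu : u 0 ∈ C)
    (hp : ∀ v ∈ C, ∑ i, rightDeriv φ |u 0 i| * |u 0 i|
      ≤ ∑ i, rightDeriv φ |u 0 i| * |v i| + ⟪p, v - u 0⟫_ℝ) :
    potentialSubgradient L (gradient f (u 0) - p) u ∈ regularSubdiff (potential f C φ L) u := by
  refine mem_regularSubdiff_of_eventually (potential_of_mem hu) fun ε hε => ?_
  have hcont : Tendsto (fun w : PiLp 2 (fun _ : Fin 3 => EuclideanSpace ℝ (Fin n)) => w 0)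
      (𝓝 u) (𝓝 (u 0)) := Continuous.tendsto (by fun_prop) u
  filter_upwards [hcont.eventually (eventually_le_objective hd hf hφ hp hε)] with w hw
  by_cases hwC : w 0 ∈ C
  · rw [potential_of_mem hwC, EReal.coe_le_coe_iff]
    have h1 := hw hwC
    have h2 := half_norm_sq_ge hL (u 2 - u 1) (w 2 - w 1)
    have h3 := half_norm_sq_ge hL (u 2 - u 0) (w 2 - w 0)
    have h4 : ‖w 0 - u 0‖ ≤ ‖w - u‖ := by simpa using PiLp.norm_apply_le (w - u) 0
    have h5 := mul_le_mul_of_nonneg_left h4 hε.le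
    have h6 : ⟪potentialSubgradient L (gradient f (u 0) - p) u, w - u⟫_ℝ
        = ⟪gradient f (u 0) - p, w 0 - u 0⟫_ℝ + L * ⟪u 2 - u 1, w 2 - w 1 - (u 2 - u 1)⟫_ℝ
          + L * ⟪u 2 - u 0, w 2 - w 0 - (u 2 - u 0)⟫_ℝ := by
      rw [PiLp.inner_apply, Fin.sum_univ_three]
      have e1 : w 2 - w 1 - (u 2 - u 1) = (w 2 - u 2) - (w 1 - u 1) := by abel
      have e2 : w 2 - w 0 - (u 2 - u 0) = (w 2 - u 2) - (w 0 - u 0) := by abel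
      rw [e1, e2, inner_sub_right (u 2 - u 1), inner_sub_right (u 2 - u 0)]
      simp only [potentialSubgradient, PiLp.toLp_apply, Matrix.cons_val_zero, Matrix.cons_val_one,
        Matrix.cons_val, PiLp.sub_apply]
      rw [inner_sub_left, inner_neg_left, inner_add_left, real_inner_smul_left,
        real_inner_smul_left, real_inner_smul_left, real_inner_smul_left]
      ring
    rw [h6]
    unfold potentialValue
    linarith
  · rw [potential_of_notMem hwC]
    exact le_top

theorem norm_le_sum_three (u : PiLp 2 (fun _ : Fin 3 => EuclideanSpace ℝ (Fin n))) :
    ‖u‖ ≤ ‖u 0‖ + ‖u 1‖ + ‖u 2‖ := by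
  rw [PiLp.norm_eq_of_L2, Fin.sum_univ_three]
  refine Real.sqrt_le_iff.2 ⟨by positivity, ?_⟩
  nlinarith [mul_nonneg (norm_nonneg (u 0)) (norm_nonneg (u 1)),
    mul_nonneg (norm_nonneg (u 0)) (norm_nonneg (u 2)),
    mul_nonneg (norm_nonneg (u 1)) (norm_nonneg (u 2))]

theorem norm_potentialSubgradient_le (hL : 0 ≤ L) (ζ : EuclideanSpace ℝ (Fin n))
    (u : PiLp 2 (fun _ : Fin 3 => EuclideanSpace ℝ (Fin n))) :
    ‖potentialSubgradient L ζ u‖ ≤ ‖ζ‖ + 2 * L * ‖u 2 - u 1‖ + 2 * L * ‖u 2 - u 0‖ := by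
  have h1 : ∀ v : EuclideanSpace ℝ (Fin n), ‖L • v‖ = L * ‖v‖ := fun v => by
    rw [norm_smul, Real.norm_of_nonneg hL]
  refine (norm_le_sum_three _).trans ?_
  simp only [potentialSubgradient, PiLp.toLp_apply, Matrix.cons_val_zero, Matrix.cons_val_one,
    Matrix.cons_val]
  have h2 := norm_sub_le ζ (L • (u 2 - u 0))
  have h3 := norm_add_le (L • (u 2 - u 1)) (L • (u 2 - u 0))
  rw [norm_neg]
  simp only [h1] at h2 h3 ⊢
  linarith

end Subgradients

end IRL

namespace IRL

/-! ### Finite length from the Kurdyka–Łojasiewicz inequality -/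

section FiniteLength

theorem IsDesingularizing.sub_ge {a : EReal} {ψ : ℝ → ℝ} (hψ : IsDesingularizing a ψ) {t r : ℝ}
    (ht : 0 < t) (hta : (t : EReal) < a) (hr : 0 ≤ r) (hra : (r : EReal) < a) :
    deriv ψ t * (t - r) ≤ ψ t - ψ r := by
  have hopen : IsOpen {t : ℝ | 0 < t ∧ (t : EReal) < a} :=
    isOpen_Ioi.inter (isOpen_Iio.preimage continuous_coe_real_ereal)
  have hd : DifferentiableAt ℝ ψ t :=
    (hψ.contDiffOn.differentiableOn one_ne_zero).differentiableAt (hopen.mem_nhds ⟨ht, hta⟩)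
  have h := hψ.concave.le_add_hasFDerivWithinAt (x := t) (y := r) ⟨ht.le, hta⟩ ⟨hr, hra⟩
    hd.hasDerivAt.hasFDerivAt.hasFDerivWithinAt
  simp at h
  linarith

theorem tendsto_zero_of_sufficient_decrease {D t : ℕ → ℝ} {c l : ℝ} (hc : 0 < c)
    (hD : ∀ k, 0 ≤ D k) (hdecr : ∀ k, c * D k ^ 2 ≤ t k - t (k + 1))
    (ht : Tendsto t atTop (𝓝 l)) : Tendsto D atTop (𝓝 0) := by
  have hsq : Tendsto (fun k => D k ^ 2) atTop (𝓝 0) := by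
    have hlim : Tendsto (fun k => (t k - t (k + 1)) / c) atTop (𝓝 0) := by
      simpa using (ht.sub ((tendsto_add_atTop_iff_nat 1).2 ht)).div_const c
    refine squeeze_zero (fun k => sq_nonneg _) (fun k => ?_) hlim
    rw [le_div_iff₀ hc, mul_comm]
    exact hdecr k
  simpa [Real.sqrt_sq (hD _)] using hsq.sqrt

/-- The finite length property. `t k` is the gap of the potential to its limit and `D k` a bound
on the step lengths; `hdecr` is sufficient decrease, and `hKL` combines the
Kurdyka–Łojasiewicz inequality near the cluster point `xbar` with the relative error bound for
subgradients. Once an iterate is close to `xbar` with a small gap, the inequality itself bounds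
the length of the remaining path, so that the sequence never leaves the region in which
the inequality is known. -/
theorem summable_of_kl {V : Type*} [NormedAddCommGroup V] {X : ℕ → V} {D t : ℕ → ℝ} {xbar : V}
    {c b ρ : ℝ} {a : EReal} {ψ : ℝ → ℝ} (hc : 0 < c) (hb : 0 < b) (hρ : 0 < ρ) (ha : 0 < a)
    (hψ : IsDesingularizing a ψ) (hD : ∀ k, 0 ≤ D k)
    (hdecr : ∀ k, c * D k ^ 2 ≤ t k - t (k + 1)) (ht : Tendsto t atTop (𝓝 0))
    (hstep : ∀ k, ‖X (k + 1) - X k‖ ≤ D (k + 1))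
    (hcluster : ∃ᶠ k in atTop, ‖X k - xbar‖ < ρ / 4)
    (hKL : ∀ k, ‖X (k + 1) - xbar‖ < ρ → D (k + 1) < ρ → 0 < t (k + 1) →
      (t (k + 1) : EReal) < a → 1 ≤ deriv ψ (t (k + 1)) * (b * (D (k + 1) + D k))) :
    Summable D := by
  have hanti : Antitone t := antitone_nat_of_succ_le fun k => by
    nlinarith [hdecr k, mul_nonneg hc.le (sq_nonneg (D k))]
  have ht0 : ∀ k, 0 ≤ t k := fun k => hanti.le_of_tendsto ht k
  by_cases hzero : ∃ k, t k = 0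
  · obtain ⟨K, hK⟩ := hzero
    have htK : ∀ k ≥ K, t k = 0 := fun k hk => le_antisymm (hK ▸ hanti hk) (ht0 k)
    refine summable_of_ne_finset_zero (s := Finset.range K) fun k hk => ?_
    have hk : K ≤ k := by simpa using hk
    have h := hdecr k
    rw [htK k hk, htK (k + 1) (by omega), sub_zero] at h
    have : D k ^ 2 ≤ 0 := by
      by_contra! h'
      linarith [mul_pos hc h']
    exact pow_eq_zero_iff two_ne_zero |>.1 (le_antisymm this (sq_nonneg _))
  push Not at hzero
  have htpos : ∀ k, 0 < t k := fun k => lt_of_le_of_ne (ht0 k) (hzero k).symm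
  have hDlim := tendsto_zero_of_sufficient_decrease hc hD hdecr ht
  have hta : ∀ᶠ k in atTop, (t k : EReal) < a := by
    obtain ⟨r, hr0, hra⟩ := EReal.lt_iff_exists_real_btwn.1 ha
    filter_upwards [ht.eventually_lt_const (u := r) (by exact_mod_cast hr0)] with k hk
    exact lt_trans (by exact_mod_cast hk) hra
  have hψlim : Tendsto (fun k => 2 * (b / c) * ψ (t k)) atTop (𝓝 0) := by
    have h0 := hψ.continuousOn 0 ⟨le_rfl, by simpa using ha⟩
    rw [ContinuousWithinAt, hψ.map_zero] at h0
    have h1 := h0.comp (tendsto_nhdsWithin_iff.2 ⟨ht, hta.mono fun k hk => ⟨ht0 k, hk⟩⟩)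
    simpa using h1.const_mul (2 * (b / c))
  obtain ⟨N₀, hN₀⟩ := eventually_atTop.1 (hta.and
    ((hDlim.eventually_lt_const (u := ρ / 4) (by linarith)).and
      (hψlim.eventually_lt_const (u := ρ / 4) (by linarith))))
  obtain ⟨M, hM, hMclose⟩ := frequently_atTop.1 hcluster (N₀ + 1)
  obtain ⟨N, rfl⟩ : ∃ N, M = N + 1 := ⟨M - 1, by omega⟩
  have hN : N₀ ≤ N := by omega
  have hpath : ∀ m, ‖X (N + 1 + m) - X (N + 1)‖ ≤
      ∑ j ∈ Finset.range m, D (N + 1 + j) + D (N + 1 + m) := by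
    have aux : ∀ m, ‖X (N + 1 + m) - X (N + 1)‖ + D (N + 1) ≤
        ∑ j ∈ Finset.range m, D (N + 1 + j) + D (N + 1 + m) := by
      intro m
      induction m with
      | zero => simp
      | succ m ih =>
        rw [Finset.sum_range_succ, ← add_assoc (N + 1) m 1]
        have h1 := norm_sub_le_norm_sub_add_norm_sub (X (N + 1 + m + 1)) (X (N + 1 + m)) (X (N + 1))
        linarith [hstep (N + 1 + m)]
    intro m
    linarith [aux m, hD (N + 1)]
  have hsum : ∀ m, ∑ j ∈ Finset.range m, D (N + 1 + j) ≤
      (D N - D (N + m)) / 2 + 2 * (b / c) * (ψ (t (N + 1)) - ψ (t (N + 1 + m))) := by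
    intro m
    induction m with
    | zero => simp
    | succ m ih =>
      obtain ⟨hta1, hD1, -⟩ := hN₀ (N + m + 1) (by omega)
      obtain ⟨hta2, -, -⟩ := hN₀ (N + m + 1 + 1) (by omega)
      have e : N + 1 + m = N + m + 1 := by omega
      have hclose : ‖X (N + m + 1) - xbar‖ < ρ := by
        have h1 := norm_sub_le_norm_sub_add_norm_sub (X (N + m + 1)) (X (N + 1)) xbar
        have h2 := hpath m
        rw [e] at h2 ih
        have h3 : 0 ≤ 2 * (b / c) * ψ (t (N + m + 1)) :=
          mul_nonneg (by positivity) (hψ.nonneg _ (ht0 _) hta1)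
        obtain ⟨-, hD2, hψ2⟩ := hN₀ (N + 1) (by omega)
        obtain ⟨-, hD3, -⟩ := hN₀ N hN
        linarith [hD (N + m)]
      have hkl := hKL (N + m) hclose (by linarith) (htpos _) hta1
      have hconc := hψ.sub_ge (htpos (N + m + 1)) hta1 (ht0 (N + m + 1 + 1)) hta2
      have hdec := hdecr (N + m + 1)
      have hder := hψ.deriv_pos _ (htpos (N + m + 1)) hta1
      rw [Finset.sum_range_succ, e, ← add_assoc N m 1,
        show N + 1 + (m + 1) = N + m + 1 + 1 by omega]
      rw [e] at ih
      set d := D (N + m + 1)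
      set d' := D (N + m)
      set Δ := ψ (t (N + m + 1)) - ψ (t (N + m + 1 + 1)) with hΔ
      have hd : 0 ≤ d := hD _
      have hd' : 0 ≤ d' := hD _
      have hS : 0 ≤ b * (d + d') := mul_nonneg hb.le (add_nonneg hd hd')
      -- The geometric mean of `(b / c) * Δ` and `d + d'` bounds `d`.
      have h1 : d ^ 2 ≤ (b / c * Δ) * (d + d') := by
        have h2 : c * d ^ 2 * 1 ≤ c * d ^ 2 * (deriv ψ (t (N + m + 1)) * (b * (d + d'))) :=
          mul_le_mul_of_nonneg_left hkl (by positivity)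
        have h3 : deriv ψ (t (N + m + 1)) * (c * d ^ 2) ≤ Δ :=
          (mul_le_mul_of_nonneg_left hdec hder.le).trans hconc
        have h4 := mul_le_mul_of_nonneg_right h3 hS
        have h5 : (b / c * Δ) * (d + d') = Δ * (b * (d + d')) / c := by field_simp
        rw [h5, le_div_iff₀ hc]
        linarith
      have hΔ0 : 0 ≤ b / c * Δ := by
        refine mul_nonneg (by positivity) (le_trans ?_ hconc)
        exact mul_nonneg hder.le (by linarith [mul_nonneg hc.le (sq_nonneg d)])
      have h6 : d ≤ b / c * Δ + (d + d') / 4 := by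
        refine le_of_sq_le_sq ?_ (by positivity)
        nlinarith [sq_nonneg (b / c * Δ - (d + d') / 4)]
      have h7 : ψ (t (N + 1)) - ψ (t (N + m + 1 + 1))
          = (ψ (t (N + 1)) - ψ (t (N + m + 1))) + Δ := by rw [hΔ]; ring
      rw [h7]
      linarith
  have hfin : Summable fun j => D (N + 1 + j) := by
    refine summable_of_sum_range_le (c := D N / 2 + 2 * (b / c) * ψ (t (N + 1)))
      (fun _ => hD _) fun m => (hsum m).trans ?_
    have h3 : 0 ≤ 2 * (b / c) * ψ (t (N + 1 + m)) :=
      mul_nonneg (by positivity) (hψ.nonneg _ (ht0 _) (hN₀ _ (by omega)).1)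
    linarith [hD (N + m)]
  refine (summable_nat_add_iff (N + 1)).1 ?_
  simpa [add_comm] using hfin

end FiniteLength

end IRL

namespace IRL

/-! ### The iterates of the algorithm -/

section Algorithm

/-- The parameter condition in the form used for sufficient decrease: the supremum is replaced
by a uniform gap `c`. -/
theorem ThetaCondition.exists_gap {θ : ℕ → ℝ} (hθ : ThetaCondition θ) :
    ∃ γ ∈ Ioo (0 : ℝ) 1, ∃ c > 0, ∀ k, θ (k + 1) ^ 2 * (1 - θ k) ^ 2 / γ ≤ θ k ^ 2 - c ∧
      θ (k + 1) ^ 2 / (1 - γ) ≤ 1 - c := by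
  obtain ⟨γ, hγ, hsup⟩ := hθ
  refine ⟨γ, hγ, _, neg_pos.2 hsup, fun k => ?_⟩
  -- An unbounded family would have the junk supremum `0`, which is not negative.
  have hbdd : BddAbove (range fun k : ℕ => max (θ (k + 1) ^ 2 * (1 - θ k) ^ 2 / γ - θ k ^ 2)
      (θ (k + 1) ^ 2 / (1 - γ) - 1)) := by
    by_contra h
    rw [Real.iSup_of_not_bddAbove h] at hsup
    exact lt_irrefl _ hsup
  have h := le_ciSup hbdd k
  have h1 := (le_max_left _ _).trans h
  have h2 := (le_max_right _ _).trans h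
  constructor <;> linarith

theorem norm_add_sq_le_div {V : Type*} [SeminormedAddCommGroup V] {γ : ℝ} (hγ : γ ∈ Ioo (0 : ℝ) 1)
    (a b : V) : ‖a + b‖ ^ 2 ≤ ‖a‖ ^ 2 / γ + ‖b‖ ^ 2 / (1 - γ) := by
  have h1 : 0 < 1 - γ := sub_pos.2 hγ.2
  have h2 : ‖a‖ ^ 2 / γ + ‖b‖ ^ 2 / (1 - γ) - (‖a‖ + ‖b‖) ^ 2
      = ((1 - γ) * ‖a‖ - γ * ‖b‖) ^ 2 / (γ * (1 - γ)) := by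
    have := hγ.1.ne'
    field_simp
    ring
  have h3 : 0 ≤ ((1 - γ) * ‖a‖ - γ * ‖b‖) ^ 2 / (γ * (1 - γ)) :=
    div_nonneg (sq_nonneg _) (mul_pos hγ.1 h1).le
  have h4 : ‖a + b‖ ^ 2 ≤ (‖a‖ + ‖b‖) ^ 2 :=
    pow_le_pow_left₀ (norm_nonneg _) (norm_add_le a b) 2
  linarith

variable {n : ℕ} {f : EuclideanSpace ℝ (Fin n) → ℝ} {C : Set (EuclideanSpace ℝ (Fin n))}
  {φ : ℝ → ℝ} {L : ℝ} {θ : ℕ → ℝ} {x y z s : ℕ → EuclideanSpace ℝ (Fin n)}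

/-- The model `v ↦ ⟪g, v - a⟫ + ∑ w_i |v_i|`: the common part of the two subproblems. -/
noncomputable def linearModel (g a w v : EuclideanSpace ℝ (Fin n)) : ℝ :=
  ⟪g, v - a⟫_ℝ + ∑ i, w i * |v i|

theorem convexOn_sum_mul_abs (hC : Convex ℝ C) {w : Fin n → ℝ} (hw : ∀ i, 0 ≤ w i) :
    ConvexOn ℝ C fun v : EuclideanSpace ℝ (Fin n) => ∑ i, w i * |v i| := by
  refine ⟨hC, fun u _ v _ a b ha hb _ => ?_⟩
  simp only [smul_eq_mul, Finset.mul_sum, ← Finset.sum_add_distrib]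
  refine Finset.sum_le_sum fun i _ => ?_
  have h : |(a • u + b • v) i| ≤ a * |u i| + b * |v i| := by
    simp only [PiLp.add_apply, PiLp.smul_apply, smul_eq_mul]
    refine (abs_add_le _ _).trans ?_
    rw [abs_mul, abs_mul, abs_of_nonneg ha, abs_of_nonneg hb]
  linarith [mul_le_mul_of_nonneg_left h (hw i)]

theorem convexOn_inner_sub {V : Type*} [NormedAddCommGroup V] [InnerProductSpace ℝ V] {S : Set V}
    (hS : Convex ℝ S) (g a : V) : ConvexOn ℝ S fun v => ⟪g, v - a⟫_ℝ := by
  refine ⟨hS, fun u _ v _ α β _ _ hαβ => le_of_eq ?_⟩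
  have : α • u + β • v - a = α • (u - a) + β • (v - a) := by
    rw [smul_sub, smul_sub, sub_add_sub_comm, ← add_smul, hαβ, one_smul]
  simp only [this, inner_add_right, real_inner_smul_right, smul_eq_mul]

theorem convexOn_linearModel (hC : Convex ℝ C) (g a : EuclideanSpace ℝ (Fin n))
    {w : EuclideanSpace ℝ (Fin n)} (hw : ∀ i, 0 ≤ w i) : ConvexOn ℝ C (linearModel g a w) :=
  (convexOn_inner_sub hC g a).add (convexOn_sum_mul_abs hC hw)

/-- The point `(1 - θ k) x k + θ k z (k + 1)`, the third component of the potential along the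
iteration. -/
def interpolant (θ : ℕ → ℝ) (x z : ℕ → EuclideanSpace ℝ (Fin n)) (k : ℕ) :
    EuclideanSpace ℝ (Fin n) :=
  (1 - θ k) • x k + θ k • z (k + 1)

/-- The point of `ℝⁿ × ℝⁿ × ℝⁿ` at which the potential is monitored after step `k`. -/
def iterateTriple (θ : ℕ → ℝ) (x z : ℕ → EuclideanSpace ℝ (Fin n)) (k : ℕ) :
    PiLp 2 (fun _ : Fin 3 => EuclideanSpace ℝ (Fin n)) :=
  WithLp.toLp 2 ![x (k + 1), x k, interpolant θ x z k]

/-- The quantity `‖z (k + 1) - x k‖ + ‖w k - x (k + 1)‖`, with `w` the interpolant, which controls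
all the displacements occurring in step `k`. -/
noncomputable def stepBound (θ : ℕ → ℝ) (x z : ℕ → EuclideanSpace ℝ (Fin n)) (k : ℕ) : ℝ :=
  ‖z (k + 1) - x k‖ + ‖interpolant θ x z k - x (k + 1)‖

@[simp] theorem iterateTriple_zero (k : ℕ) : iterateTriple θ x z k 0 = x (k + 1) := rfl

@[simp] theorem iterateTriple_one (k : ℕ) : iterateTriple θ x z k 1 = x k := rfl

@[simp] theorem iterateTriple_two (k : ℕ) : iterateTriple θ x z k 2 = interpolant θ x z k := rfl

theorem stepBound_nonneg (k : ℕ) : 0 ≤ stepBound θ x z k := by unfold stepBound; positivity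

theorem interpolant_sub (k : ℕ) : interpolant θ x z k - x k = θ k • (z (k + 1) - x k) := by
  unfold interpolant; module

theorem sub_interpolant (k : ℕ) :
    z (k + 1) - interpolant θ x z k = (1 - θ k) • (z (k + 1) - x k) := by
  unfold interpolant; module

theorem norm_smul_le_of_mem_Icc {V : Type*} [SeminormedAddCommGroup V] [NormedSpace ℝ V] {t : ℝ}
    (ht : t ∈ Icc (0 : ℝ) 1) (v : V) : ‖t • v‖ ≤ ‖v‖ := by
  rw [norm_smul, Real.norm_of_nonneg ht.1]
  exact mul_le_of_le_one_left (norm_nonneg v) ht.2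

namespace IsIRL1e3

theorem theta_mem_Icc (h : IsIRL1e3 f C φ L θ x y z s) (k : ℕ) : θ k ∈ Icc (0 : ℝ) 1 :=
  Ioc_subset_Icc_self (h.theta_mem k)

theorem x_mem (h : IsIRL1e3 f C φ L θ x y z s) : ∀ k, x k ∈ C
  | 0 => h.x_zero
  | k + 1 => (h.x_step k).1

theorem norm_interpolant_sub_le (h : IsIRL1e3 f C φ L θ x y z s) (k : ℕ) :
    ‖interpolant θ x z k - x k‖ ≤ ‖z (k + 1) - x k‖ := by
  rw [interpolant_sub]
  exact norm_smul_le_of_mem_Icc (h.theta_mem_Icc k) _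

theorem norm_sub_le_stepBound (h : IsIRL1e3 f C φ L θ x y z s) (k : ℕ) :
    ‖x (k + 1) - x k‖ ≤ stepBound θ x z k := by
  have h1 := norm_sub_le_norm_sub_add_norm_sub (x (k + 1)) (interpolant θ x z k) (x k)
  rw [norm_sub_rev (x (k + 1)) (interpolant θ x z k)] at h1
  have h2 := h.norm_interpolant_sub_le k
  unfold stepBound
  linarith

theorem norm_sub_y_le (h : IsIRL1e3 f C φ L θ x y z s) (k : ℕ) :
    ‖x (k + 1 + 1) - y (k + 1)‖ ≤ stepBound θ x z (k + 1) + stepBound θ x z k := by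
  have h1 := norm_sub_le_norm_sub_add_norm_sub (x (k + 1 + 1)) (x (k + 1)) (y (k + 1))
  have h2 := h.norm_sub_le_stepBound (k + 1)
  have h3 : x (k + 1) - y (k + 1) = θ (k + 1) • -(z (k + 1) - x (k + 1)) := by
    rw [h.y_step]; module
  have h4 := norm_smul_le_of_mem_Icc (h.theta_mem_Icc (k + 1)) (-(z (k + 1) - x (k + 1)))
  rw [← h3, norm_neg] at h4
  have h5 := norm_sub_le_norm_sub_add_norm_sub (z (k + 1)) (interpolant θ x z k) (x (k + 1))
  rw [sub_interpolant] at h5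
  have h6 := norm_smul_le_of_mem_Icc (t := 1 - θ k)
    ⟨sub_nonneg.2 (h.theta_mem_Icc k).2, sub_le_self _ (h.theta_mem_Icc k).1⟩ (z (k + 1) - x k)
  have h7 : stepBound θ x z k = ‖z (k + 1) - x k‖ + ‖interpolant θ x z k - x (k + 1)‖ := rfl
  linarith

theorem s_nonneg (h : IsIRL1e3 f C φ L θ x y z s) (hφ : IsPenalty φ) (k : ℕ) (i : Fin n) :
    0 ≤ s (k + 1) i := by
  rw [h.s_step]
  exact hφ.rightDeriv_nonneg (abs_nonneg _)

theorem isArgmin_x (h : IsIRL1e3 f C φ L θ x y z s) (k : ℕ) :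
    IsArgmin (fun v => linearModel (gradient f (y k)) (y k) (s (k + 1)) v
      + L / 2 * ‖v - y k‖ ^ 2) C (x (k + 1)) := by
  convert h.x_step k using 2 with v
  unfold linearModel
  ring

theorem isArgmin_z (h : IsIRL1e3 f C φ L θ x y z s) (k : ℕ) :
    IsArgmin (fun v => linearModel (gradient f (y k)) (y k) (s (k + 1)) v
      + L * θ k / 2 * ‖v - z k‖ ^ 2) C (z (k + 1)) := by
  convert h.z_step k using 2 with v
  unfold linearModel
  ring

/-- One step of the algorithm. The `x`-subproblem is compared with the interpolant, and the
value there is bounded by convexity and the `z`-subproblem. -/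
theorem potentialValue_le (h : IsIRL1e3 f C φ L θ x y z s) (hd : Differentiable ℝ f)
    (hf : ConvexOn ℝ univ f) (hlip : ∀ u v, ‖gradient f u - gradient f v‖ ≤ L * ‖u - v‖)
    (hC : Convex ℝ C) (hφ : IsPenalty φ) (k : ℕ) :
    potentialValue f φ L (iterateTriple θ x z k)
      ≤ f (x k) + penalty φ (x k) + L / 2 * (θ k ^ 2 * ‖x k - z k‖ ^ 2) := by
  obtain ⟨hθ0, hθ1⟩ := h.theta_mem_Icc k
  have hconv := convexOn_linearModel hC (gradient f (y k)) (y k) (h.s_nonneg hφ k)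
  set m := linearModel (gradient f (y k)) (y k) (s (k + 1))
  have hz := (h.z_step k).1
  have hwC : interpolant θ x z k ∈ C :=
    hC (h.x_mem k) hz (sub_nonneg.2 hθ1) hθ0 (by ring)
  have h1 := le_add_inner_gradient_add_sq hd hlip (y k) (x (k + 1))
  have h2 := hφ.penalty_le (x k) (x (k + 1))
  have h3 := (h.isArgmin_x k).quadratic_growth hconv hwC
  have h4 : m (interpolant θ x z k) ≤ _ :=
    hconv.2 (h.x_mem k) hz (sub_nonneg.2 hθ1) hθ0 (by ring)
  have h5 := mul_le_mul_of_nonneg_left ((h.isArgmin_z k).quadratic_growth hconv (h.x_mem k)) hθ0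
  have h6 := hf.add_inner_gradient_le hd (y k) (x k)
  have e1 : ‖interpolant θ x z k - y k‖ ^ 2 = θ k ^ 2 * ‖z (k + 1) - z k‖ ^ 2 := by
    have : interpolant θ x z k - y k = θ k • (z (k + 1) - z k) := by
      rw [h.y_step]; unfold interpolant; module
    rw [this, norm_smul, mul_pow, Real.norm_eq_abs, sq_abs]
  have e2 : ‖interpolant θ x z k - x k‖ ^ 2 = θ k ^ 2 * ‖x k - z (k + 1)‖ ^ 2 := by
    rw [interpolant_sub, norm_smul, mul_pow, Real.norm_eq_abs, sq_abs, norm_sub_rev]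
  simp only [← h.s_step, mul_sub, Finset.sum_sub_distrib] at h2
  have m1 : m (x (k + 1)) = ⟪gradient f (y k), x (k + 1) - y k⟫_ℝ
    + ∑ i, s (k + 1) i * |x (k + 1) i| := rfl
  have m2 : m (x k) = ⟪gradient f (y k), x k - y k⟫_ℝ + ∑ i, s (k + 1) i * |x k i| := rfl
  simp only [smul_eq_mul] at h4
  rw [e1] at h3
  simp only [potentialValue, iterateTriple_zero, iterateTriple_one, iterateTriple_two]
  rw [e2]
  linarith

theorem potentialValue_succ_le (h : IsIRL1e3 f C φ L θ x y z s) (hL : 0 ≤ L)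
    (hd : Differentiable ℝ f) (hf : ConvexOn ℝ univ f)
    (hlip : ∀ u v, ‖gradient f u - gradient f v‖ ≤ L * ‖u - v‖)
    (hC : Convex ℝ C) (hφ : IsPenalty φ) {γ c : ℝ} (hγ : γ ∈ Ioo (0 : ℝ) 1) (hc : 0 ≤ c)
    (hθ : ∀ k, θ (k + 1) ^ 2 * (1 - θ k) ^ 2 / γ ≤ θ k ^ 2 - c ∧ θ (k + 1) ^ 2 / (1 - γ) ≤ 1 - c)
    (k : ℕ) :
    L * c / 4 * stepBound θ x z k ^ 2 ≤ potentialValue f φ L (iterateTriple θ x z k)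
      - potentialValue f φ L (iterateTriple θ x z (k + 1)) := by
  have h1 := h.potentialValue_le hd hf hlip hC hφ (k + 1)
  obtain ⟨hθ1, hθ2⟩ := hθ k
  set A := ‖z (k + 1) - x k‖ with hA
  set B := ‖interpolant θ x z k - x (k + 1)‖ with hB
  have h2 : θ (k + 1) ^ 2 * ‖x (k + 1) - z (k + 1)‖ ^ 2
      ≤ (θ k ^ 2 - c) * A ^ 2 + (1 - c) * B ^ 2 := by
    have e : z (k + 1) - x (k + 1)
        = (1 - θ k) • (z (k + 1) - x k) + (interpolant θ x z k - x (k + 1)) := by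
      rw [← sub_interpolant]; abel
    have h3 := norm_add_sq_le_div hγ ((1 - θ k) • (z (k + 1) - x k))
      (interpolant θ x z k - x (k + 1))
    rw [← e, norm_smul, mul_pow, Real.norm_eq_abs, sq_abs, ← hA, ← hB] at h3
    have h4 := mul_le_mul_of_nonneg_left h3 (sq_nonneg (θ (k + 1)))
    have h5 := mul_le_mul_of_nonneg_right hθ1 (sq_nonneg A)
    have h6 := mul_le_mul_of_nonneg_right hθ2 (sq_nonneg B)
    rw [norm_sub_rev]
    calc _ ≤ _ := h4
      _ = θ (k + 1) ^ 2 * (1 - θ k) ^ 2 / γ * A ^ 2 + θ (k + 1) ^ 2 / (1 - γ) * B ^ 2 := by ring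
      _ ≤ _ := add_le_add h5 h6
  have h3 := mul_le_mul_of_nonneg_left h2 (div_nonneg hL zero_le_two)
  have h4 : potentialValue f φ L (iterateTriple θ x z k)
      = f (x (k + 1)) + penalty φ (x (k + 1)) + L / 2 * (θ k ^ 2 * A ^ 2) + L / 2 * B ^ 2 := by
    simp only [potentialValue, iterateTriple_zero, iterateTriple_one, iterateTriple_two]
    rw [interpolant_sub, norm_smul, mul_pow, Real.norm_eq_abs, sq_abs]
  have h5 : stepBound θ x z k = A + B := rfl
  rw [h4, h5]
  nlinarith [mul_nonneg (mul_nonneg hL hc) (sq_nonneg (A - B))]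

/-- The optimality condition of the `x`-subproblem with the weights moved from the previous
iterate to the current one. The resulting error is a Lipschitz perturbation, which the sum
rule turns into a change of the linear term. -/
theorem exists_subgradient (h : IsIRL1e3 f C φ L θ x y z s) (hL : 0 ≤ L) (hC : Convex ℝ C)
    (hlip : ∀ u v, ‖gradient f u - gradient f v‖ ≤ L * ‖u - v‖) (hφ : IsPenalty φ)
    {K : NNReal} (hK : LipschitzOnWith K (rightDeriv φ) (Ici 0)) (k : ℕ) :
    ∃ p : EuclideanSpace ℝ (Fin n),
      (∀ v ∈ C, ∑ i, rightDeriv φ |x (k + 1) i| * |x (k + 1) i|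
        ≤ ∑ i, rightDeriv φ |x (k + 1) i| * |v i| + ⟪p, v - x (k + 1)⟫_ℝ) ∧
      ‖gradient f (x (k + 1)) - p‖
        ≤ 2 * L * ‖x (k + 1) - y k‖ + n * K * ‖x (k + 1) - x k‖ := by
  set X := x (k + 1) with hX
  set g := gradient f (y k) + L • (X - y k) with hg
  have hconv := convexOn_linearModel hC (gradient f (y k)) (y k) (h.s_nonneg hφ k)
  have hopt : ∀ v ∈ C, ∑ i, s (k + 1) i * |X i|
      ≤ ∑ i, s (k + 1) i * |v i| + ⟪g, v - X⟫_ℝ := by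
    intro v hv
    have h1 := (h.isArgmin_x k).linearized hconv hv
    have e : v - y k = (v - X) + (X - y k) := by abel
    simp only [linearModel] at h1
    rw [e, inner_add_right, ← hX] at h1
    rw [hg, inner_add_left, real_inner_smul_left]
    linarith
  have hswap : ∀ v : EuclideanSpace ℝ (Fin n),
      ∑ i, (s (k + 1) i - rightDeriv φ |X i|) * (|v i| - |X i|)
        ≤ n * K * ‖X - x k‖ * ‖v - X‖ := by
    intro v
    have h1 : ∀ i, (s (k + 1) i - rightDeriv φ |X i|) * (|v i| - |X i|)
        ≤ K * ‖X - x k‖ * ‖v - X‖ := by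
      intro i
      have hcoord : ∀ a b : EuclideanSpace ℝ (Fin n), |(|a i| - |b i|)| ≤ ‖a - b‖ := fun a b =>
        (abs_abs_sub_abs_le_abs_sub _ _).trans (by simpa using PiLp.norm_apply_le (a - b) i)
      have h2 : |s (k + 1) i - rightDeriv φ (|X i|)| ≤ K * ‖X - x k‖ := by
        have h3 := hK.dist_le_mul |x k i| (mem_Ici.2 (abs_nonneg _)) |X i|
          (mem_Ici.2 (abs_nonneg _))
        rw [Real.dist_eq, Real.dist_eq, ← h.s_step] at h3
        refine h3.trans (mul_le_mul_of_nonneg_left ?_ K.coe_nonneg)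
        rw [norm_sub_rev]
        exact hcoord _ _
      calc _ ≤ |(s (k + 1) i - rightDeriv φ |X i|) * (|v i| - |X i|)| := le_abs_self _
        _ = |s (k + 1) i - rightDeriv φ (|X i|)| * |(|v i| - |X i|)| := abs_mul _ _
        _ ≤ _ := mul_le_mul h2 (hcoord _ _) (abs_nonneg _) (by positivity)
    refine (Finset.sum_le_sum fun i _ => h1 i).trans (le_of_eq ?_)
    simp only [Finset.sum_const, Finset.card_univ, Fintype.card_fin, nsmul_eq_mul]
    ring
  obtain ⟨p, hp, hpmin⟩ := exists_norm_le_forall_add_inner_nonneg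
    (h := fun v => ∑ i, rightDeriv φ |X i| * |v i| + ⟪g, v - X⟫_ℝ) (C := C) (x := X)
    (ε := n * K * ‖X - x k‖) (by positivity)
    ((convexOn_sum_mul_abs hC fun i => hφ.rightDeriv_nonneg (abs_nonneg _)).add
      (convexOn_inner_sub hC g X)) (h.x_mem _) (by
      intro v hv
      have h1 := hopt v hv
      have h2 := hswap v
      simp only [sub_mul, mul_sub, Finset.sum_sub_distrib] at h2
      rw [sub_self, inner_zero_right]
      linarith)
  refine ⟨g + p, fun v hv => ?_, ?_⟩
  · have h1 := hpmin v hv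
    rw [sub_self, inner_zero_right] at h1
    rw [inner_add_left]
    linarith
  · have e : gradient f X - (g + p)
        = (gradient f X - gradient f (y k)) - L • (X - y k) - p := by
      rw [hg]; abel
    rw [e]
    have h1 := norm_sub_le ((gradient f X - gradient f (y k)) - L • (X - y k)) p
    have h2 := norm_sub_le (gradient f X - gradient f (y k)) (L • (X - y k))
    rw [norm_smul, Real.norm_of_nonneg hL] at h2
    linarith [hlip X (y k)]

theorem norm_iterateTriple_sub_le (h : IsIRL1e3 f C φ L θ x y z s) (k : ℕ)
    (xbar : EuclideanSpace ℝ (Fin n)) :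
    ‖iterateTriple θ x z k - WithLp.toLp 2 ![xbar, xbar, xbar]‖
      ≤ 3 * ‖x (k + 1) - xbar‖ + 2 * stepBound θ x z k := by
  refine (norm_le_sum_three _).trans ?_
  simp only [PiLp.sub_apply, iterateTriple_zero, iterateTriple_one, iterateTriple_two,
    Matrix.cons_val_zero, Matrix.cons_val_one, Matrix.cons_val]
  have h1 := norm_sub_le_norm_sub_add_norm_sub (x k) (x (k + 1)) xbar
  rw [norm_sub_rev (x k) (x (k + 1))] at h1
  have h2 := h.norm_sub_le_stepBound k
  have h3 := norm_sub_le_norm_sub_add_norm_sub (interpolant θ x z k) (x (k + 1)) xbar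
  have h4 : ‖interpolant θ x z k - x (k + 1)‖ ≤ stepBound θ x z k :=
    le_add_of_nonneg_left (norm_nonneg _)
  linarith

end IsIRL1e3

end Algorithm

end IRL

/-! ### Convergence -/

namespace IRL

variable {n : ℕ} {f : EuclideanSpace ℝ (Fin n) → ℝ} {C : Set (EuclideanSpace ℝ (Fin n))}
  {φ : ℝ → ℝ} {L : ℝ} {θ : ℕ → ℝ} {x y z s : ℕ → EuclideanSpace ℝ (Fin n)}

theorem IsIRL1e3.exists_bound (h : IsIRL1e3 f C φ L θ x y z s) (hL : 0 ≤ L)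
    (hF : LevelBounded (objective f C φ))
    (hanti : Antitone fun k => potentialValue f φ L (iterateTriple θ x z k)) :
    ∃ R, ∀ k, ‖x (k + 1)‖ ≤ R := by
  obtain ⟨R, hR⟩ := (hF (potentialValue f φ L (iterateTriple θ x z 0))).exists_norm_le
  refine ⟨R, fun k => hR _ ?_⟩
  have h1 : potentialValue f φ L (iterateTriple θ x z k)
      ≤ potentialValue f φ L (iterateTriple θ x z 0) := hanti (Nat.zero_le k)
  have h2 : f (x (k + 1)) + penalty φ (x (k + 1))
      ≤ potentialValue f φ L (iterateTriple θ x z k) := by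
    simp only [potentialValue, iterateTriple_zero, add_assoc]
    gcongr
    exact le_add_of_nonneg_right (by positivity)
  rw [mem_ofPred_eq, objective_of_mem (h.x_mem _)]
  exact_mod_cast h2.trans h1

theorem potentialValue_ge (hL : 0 ≤ L) (hd : Differentiable ℝ f) (hf : ConvexOn ℝ univ f)
    (hφ : IsPenalty φ) (u : PiLp 2 (fun _ : Fin 3 => EuclideanSpace ℝ (Fin n))) :
    f 0 - ‖gradient f 0‖ * ‖u 0‖ ≤ potentialValue f φ L u := by
  have h1 := hf.add_inner_gradient_le hd 0 (u 0)
  rw [sub_zero] at h1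
  have h2 := neg_le_of_abs_le (abs_real_inner_le_norm (gradient f 0) (u 0))
  have h3 := hφ.penalty_nonneg (u 0)
  have h4 : 0 ≤ L / 2 * ‖u 2 - u 1‖ ^ 2 := by positivity
  have h5 : 0 ≤ L / 2 * ‖u 2 - u 0‖ ^ 2 := by positivity
  unfold potentialValue
  linarith

/-- The Kurdyka–Łojasiewicz inequality in real form: finite values, and the norm of one subgradient
in place of the distance to the subdifferential. -/
theorem one_le_deriv_mul_norm {V : Type*} [NormedAddCommGroup V]
    [InnerProductSpace ℝ V] {h : V → EReal} {u ubar g : V} {a : EReal} {ψ : ℝ → ℝ} {r rbar : ℝ}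
    (hψ : IsDesingularizing a ψ)
    (hKL : h ubar < h u → h u < h ubar + a →
      1 ≤ ENNReal.ofReal (deriv ψ (h u - h ubar).toReal) * Metric.infEDist 0 (subdiff h u))
    (hu : h u = r) (hubar : h ubar = rbar) (hpos : 0 < r - rbar) (ha : ((r - rbar : ℝ) : EReal) < a)
    (hg : g ∈ subdiff h u) : 1 ≤ deriv ψ (r - rbar) * ‖g‖ := by
  have hgap : h u - h ubar = ((r - rbar : ℝ) : EReal) := by rw [hu, hubar, EReal.coe_sub]
  have h1 : h ubar < h u := by
    rw [hu, hubar]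
    exact_mod_cast sub_pos.1 hpos
  have h2 : h u < h ubar + a := by
    have h3 := EReal.add_lt_add_left_coe ha rbar
    rw [hu, hubar]
    convert h3 using 1
    norm_cast
    ring
  have h4 := hKL h1 h2
  rw [hgap, EReal.toReal_coe] at h4
  have h5 : Metric.infEDist 0 (subdiff h u) ≤ ENNReal.ofReal ‖g‖ := by
    refine (Metric.infEDist_le_edist_of_mem hg).trans (le_of_eq ?_)
    rw [edist_dist, dist_zero_left]
  have h6 := h4.trans (mul_le_mul_right h5 _)
  rw [← ENNReal.ofReal_mul (hψ.deriv_pos _ hpos ha).le] at h6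
  exact ENNReal.one_le_ofReal.1 h6

end IRL

theorem theorem5p4 (n : ℕ)
    (f : EuclideanSpace ℝ (Fin n) → ℝ) (C : Set (EuclideanSpace ℝ (Fin n)))
    (φ : ℝ → ℝ) (L : ℝ)
    (hL : 0 < L)
    (hf_diff : Differentiable ℝ f)
    (hf_conv : ConvexOn ℝ Set.univ f)
    (hf_lip : ∀ u v, ‖gradient f u - gradient f v‖ ≤ L * ‖u - v‖)
    (hC_ne : C.Nonempty) (hC_closed : IsClosed C) (hC_conv : Convex ℝ C)
    (hφ : IRL.IsPenalty φ)
    (hF : IRL.LevelBounded (IRL.objective f C φ))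
    (θ : ℕ → ℝ) (x y z s : ℕ → EuclideanSpace ℝ (Fin n))
    (halg : IRL.IsIRL1e3 f C φ L θ x y z s)
    (hθ : IRL.ThetaCondition θ)
    (hKL : IRL.IsKLFunction (IRL.potential f C φ L))
    (hφ_lip : ∃ K : NNReal, LipschitzOnWith K (IRL.rightDeriv φ) (Set.Ici 0)) :
    Summable (fun k : ℕ => ‖x (k + 1) - x k‖) ∧
      ∃ xbar : EuclideanSpace ℝ (Fin n),
        Filter.Tendsto x Filter.atTop (nhds xbar) ∧
          IRL.IsStationaryPoint (IRL.objective f C φ) xbar := by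
  open IRL in
  obtain ⟨K, hK⟩ := hφ_lip
  obtain ⟨γ, hγ, c, hc, hgap⟩ := hθ.exists_gap
  set U := iterateTriple θ x z
  set D := stepBound θ x z
  have hD0 : ∀ k, 0 ≤ D k := fun k => stepBound_nonneg k
  have hc' : 0 < L * c / 4 := by positivity
  have hdecr : ∀ k, L * c / 4 * D k ^ 2
      ≤ potentialValue f φ L (U k) - potentialValue f φ L (U (k + 1)) :=
    halg.potentialValue_succ_le hL.le hf_diff hf_conv hf_lip hC_conv hφ hγ hc.le hgap
  have hanti : Antitone fun k => potentialValue f φ L (U k) := antitone_nat_of_succ_le fun k => by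
    linarith [hdecr k, mul_nonneg hc'.le (sq_nonneg (D k))]
  obtain ⟨R, hR⟩ := halg.exists_bound hL.le hF hanti
  have hbdd : BddBelow (range fun k => potentialValue f φ L (U k)) := by
    refine ⟨f 0 - ‖gradient f 0‖ * R, ?_⟩
    rintro _ ⟨k, rfl⟩
    refine le_trans ?_ (potentialValue_ge hL.le hf_diff hf_conv hφ (U k))
    exact sub_le_sub_left (mul_le_mul_of_nonneg_left (hR k) (norm_nonneg _)) _
  have hlim := tendsto_atTop_ciInf hanti hbdd
  set E := ⨅ k, potentialValue f φ L (U k)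
  have hDlim : Tendsto D atTop (𝓝 0) := tendsto_zero_of_sufficient_decrease hc' hD0 hdecr hlim
  obtain ⟨xbar, -, σ, hσ, hxσ⟩ := tendsto_subseq_of_bounded
    (Metric.isBounded_closedBall (x := (0 : EuclideanSpace ℝ (Fin n))) (r := R))
    (x := fun k => x (k + 1)) (fun k => by simpa using hR k)
  have hxbar : xbar ∈ C := hC_closed.mem_of_tendsto hxσ (Eventually.of_forall fun k => halg.x_mem _)
  set ubar : PiLp 2 (fun _ : Fin 3 => EuclideanSpace ℝ (Fin n)) :=
    WithLp.toLp 2 ![xbar, xbar, xbar]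
  have hUσ : Tendsto (fun j => U (σ j)) atTop (𝓝 ubar) := by
    rw [tendsto_iff_norm_sub_tendsto_zero]
    have h1 := (tendsto_iff_norm_sub_tendsto_zero.1 hxσ).const_mul 3
    have h2 := (hDlim.comp hσ.tendsto_atTop).const_mul 2
    have h3 := h1.add h2
    simp only [mul_zero, add_zero] at h3
    exact squeeze_zero (fun _ => norm_nonneg _)
      (fun j => halg.norm_iterateTriple_sub_le (σ j) xbar) h3
  have hpotcont : Continuous (potentialValue f φ L) :=
    continuous_potentialValue hf_diff.continuous hφ
  have hE : potentialValue f φ L ubar = E :=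
    tendsto_nhds_unique ((hpotcont.tendsto ubar).comp hUσ) (hlim.comp hσ.tendsto_atTop)
  have hpot : ∀ k, potential f C φ L (U k) = (potentialValue f φ L (U k) : EReal) := fun k =>
    potential_of_mem (halg.x_mem (k + 1))
  have hpotbar : potential f C φ L ubar = (E : EReal) := by
    rw [potential_of_mem (by exact hxbar), hE]
  choose p hpmin hpnorm using
    halg.exists_subgradient hL.le hC_conv hf_lip hφ hK
  set ζ : ℕ → EuclideanSpace ℝ (Fin n) := fun k => gradient f (x (k + 1)) - p k
  have hζmem : ∀ k, ζ k ∈ regularSubdiff (objective f C φ) (x (k + 1)) := fun k =>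
    sub_mem_regularSubdiff_objective hf_diff hf_conv hφ (halg.x_mem _) (hpmin k)
  set G : ℕ → PiLp 2 (fun _ : Fin 3 => EuclideanSpace ℝ (Fin n)) :=
    fun k => potentialSubgradient L (ζ k) (U k)
  have hGmem : ∀ k, G k ∈ regularSubdiff (potential f C φ L) (U k) := fun k =>
    potentialSubgradient_mem_regularSubdiff hL.le hf_diff hf_conv hφ (halg.x_mem _) (hpmin k)
  set b := 6 * L + n * K with hb_def
  have hb : 0 < b := by positivity
  have hKn : (0 : ℝ) ≤ n * K := by positivity
  have hζnorm : ∀ k, ‖ζ (k + 1)‖ ≤ (2 * L + n * K) * (D (k + 1) + D k) := by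
    intro k
    have h1 := mul_le_mul_of_nonneg_left (halg.norm_sub_y_le k) (by positivity : 0 ≤ 2 * L)
    have h2 := mul_le_mul_of_nonneg_left (halg.norm_sub_le_stepBound (k + 1)) hKn
    have h3 := mul_nonneg hKn (hD0 k)
    have h4 := hpnorm (k + 1)
    calc ‖ζ (k + 1)‖ ≤ _ := h4
      _ ≤ 2 * L * (D (k + 1) + D k) + n * K * D (k + 1) := add_le_add h1 h2
      _ ≤ _ := by linarith
  have hGnorm : ∀ k, ‖G (k + 1)‖ ≤ b * (D (k + 1) + D k) := by
    intro k
    have h1 := norm_potentialSubgradient_le hL.le (ζ (k + 1)) (U (k + 1))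
    have h2 : ‖U (k + 1) 2 - U (k + 1) 1‖ ≤ D (k + 1) :=
      (halg.norm_interpolant_sub_le (k + 1)).trans (le_add_of_nonneg_right (norm_nonneg _))
    have h3 : ‖U (k + 1) 2 - U (k + 1) 0‖ ≤ D (k + 1) :=
      le_add_of_nonneg_left (norm_nonneg _)
    have h4 := mul_le_mul_of_nonneg_left h2 (by positivity : 0 ≤ 2 * L)
    have h5 := mul_le_mul_of_nonneg_left h3 (by positivity : 0 ≤ 2 * L)
    have h6 := mul_nonneg hL.le (hD0 k)
    have h7 : b * (D (k + 1) + D k) = (2 * L + n * K) * (D (k + 1) + D k)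
        + 4 * L * D (k + 1) + 4 * (L * D k) := by rw [hb_def]; ring
    linarith [hζnorm k]
  have hDsum : Tendsto (fun k => D (k + 1) + D k) atTop (𝓝 0) := by
    simpa using ((tendsto_add_atTop_iff_nat 1).2 hDlim).add hDlim
  have hζlim : Tendsto ζ atTop (𝓝 0) := by
    refine (tendsto_add_atTop_iff_nat 1).1 (squeeze_zero_norm hζnorm ?_)
    simpa using hDsum.const_mul (2 * L + n * K)
  have hGlim : Tendsto G atTop (𝓝 0) := by
    refine (tendsto_add_atTop_iff_nat 1).1 (squeeze_zero_norm hGnorm ?_)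
    simpa using hDsum.const_mul b
  have hcrit : ubar ∈ domSubdiff (potential f C φ L) := by
    refine ⟨0, by simp [dom, hpotbar], fun j => U (σ j), fun j => G (σ j), hUσ, ?_,
      hGlim.comp hσ.tendsto_atTop, fun j => hGmem _⟩
    simp only [hpot, hpotbar]
    exact (continuous_coe_real_ereal.tendsto E).comp (hlim.comp hσ.tendsto_atTop)
  -- The inequality is needed only at this one cluster point; no uniform version over the limit
  -- set is used.
  obtain ⟨a, ha, W, hW, ψ, hψ, hkl⟩ := hKL.2.2 ubar hcrit
  obtain ⟨r, hr, hrW⟩ := Metric.mem_nhds_iff.1 hW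
  have hDsummable : Summable D := by
    refine summable_of_kl (X := fun k => x (k + 1)) (xbar := xbar) (ρ := r / 5)
      (t := fun k => potentialValue f φ L (U k) - E) hc' hb (by positivity) ha hψ hD0
      (fun k => by simpa using hdecr k) (by simpa using hlim.sub_const E)
      (fun k => halg.norm_sub_le_stepBound (k + 1)) ?_ ?_
    · have h1 := (tendsto_iff_norm_sub_tendsto_zero.1 hxσ).eventually_lt_const
        (u := r / 5 / 4) (by positivity)
      exact hσ.tendsto_atTop.frequently h1.frequently
    · intro k hX hDk hpos hta
      have hmem : U (k + 1) ∈ W := by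
        refine hrW (mem_ball_iff_norm.2 ?_)
        have h1 := halg.norm_iterateTriple_sub_le (k + 1) xbar
        linarith
      have h1 := one_le_deriv_mul_norm hψ (hkl _ hmem) (hpot _) hpotbar hpos hta
        (regularSubdiff_subset_subdiff _ _ (hGmem (k + 1)))
      exact h1.trans (mul_le_mul_of_nonneg_left (hGnorm k) (hψ.deriv_pos _ hpos hta).le)
  have hsummable : Summable fun k => ‖x (k + 1) - x k‖ :=
    hDsummable.of_nonneg_of_le (fun _ => norm_nonneg _) halg.norm_sub_le_stepBound
  have hx : Tendsto x atTop (𝓝 xbar) := by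
    have hcauchy : CauchySeq x := cauchySeq_of_summable_dist (by
      simpa only [dist_eq_norm, norm_sub_rev] using hsummable)
    obtain ⟨l, hl⟩ := cauchySeq_tendsto_of_complete hcauchy
    have h1 := ((tendsto_add_atTop_iff_nat 1).2 hl).comp hσ.tendsto_atTop
    rwa [tendsto_nhds_unique hxσ h1]
  have hx1 : Tendsto (fun k => x (k + 1)) atTop (𝓝 xbar) := (tendsto_add_atTop_iff_nat 1).2 hx
  refine ⟨hsummable, xbar, hx, by
    rw [dom, mem_ofPred_eq, objective_of_mem hxbar]
    exact EReal.coe_lt_top _, fun k => x (k + 1), ζ, hx1,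
    ?_, hζlim, hζmem⟩
  simp only [objective_of_mem (halg.x_mem _), objective_of_mem hxbar]
  have hcont : Continuous fun v : EuclideanSpace ℝ (Fin n) => f v + penalty φ v :=
    hf_diff.continuous.add hφ.continuous_penalty
  exact ((continuous_coe_real_ereal.comp hcont).tendsto xbar).comp hx1
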